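/- **Theorem A.1.** Let $d \ge 1$ and let $\Omega \subset \mathbb{R}^d$ be a bounded Lipschitz domain, that is, a nonempty, bounded, open, connected set which near each of its boundary points is, after a rigid motion, the part of space lying strictly above the graph of a Lipschitz function. The Neumann Laplacian $-\Delta_N$ is defined as follows: $u \in \mathrm{Dom}(-\Delta_N)$ and $-\Delta_N u = w$ mean that $u \in H^1(\Omega)$, $w \in L^2(\Omega)$ and $\int_\Omega w\,v\,dx = \int_\Omega \nabla u\cdot\nabla v\,dx$ for all $v \in H^1(\Omega)$ (all functions being real-valued). Then $L^2(\Omega)$ has an orthonormal basis $(\psi_k)_{k\ge 0}$ of eigenfunctions of $-\Delta_N$, $-\Delta_N\psi_k = \lambda_k\psi_k$, whose eigenvalues satisfy $0=\lambda_0<\lambda_1\le\lambda_2\le\cdots$ and $\lambda_k \to +\infty$. Fix any such basis and let $s \in (0,1)$. For $u \in L^2(\Omega)$ put $u_k := \int_\Omega u\,\psi_k\,dx$. Let $$\mathbb{H}^s_*(\Omega) := \Big\{ u = \sum_{k\ge1} u_k\psi_k \in L^2(\Omega) \;:\; \int_\Omega u\,dx = 0,\ \ \|u\|_{\mathbb{H}^s_*(\Omega)}^2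 := \sum_{k\ge 1}\lambda_k^s u_k^2 < \infty \Big\},$$ let $\mathbb{H}^{-s}_*(\Omega)$ be its dual space with the dual norm and duality pairing $\langle\cdot,\cdot\rangle$, and let $(-\Delta_N)^{s/2}u := \sum_{k\ge1}\lambda_k^{s/2}u_k\psi_k \in L^2(\Omega)$ for $u \in \mathbb{H}^s_*(\Omega)$. Then for every $f \in \mathbb{H}^{-s}_*(\Omega)$ the fractional Poisson problem $(-\Delta_N)^s u = f$ in $\Omega$ has a unique weak solution, i.e. there is exactly one $u \in \mathbb{H}^s_*(\Omega)$ such that $$\int_\Omega \big((-\Delta_N)^{s/2}u\big)\big((-\Delta_N)^{s/2}v\big)\,dx = \langle f, v\rangle \qquad \text{for all } v \in \mathbb{H}^s_*(\Omega),$$ and this $u$ satisfies $$\|u\|_{\mathbb{H}^s_*(\Omega)} \le \|f\|_{\mathbb{H}^{-s}_*(\Omega)}.$$ -/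

import Mathlib

open MeasureTheory Filter Topology
open scoped ENNReal ContDiff InnerProductSpace

noncomputable section

namespace FracNeumann

/-! ### Domains -/

/-- `Ω` has a Lipschitz boundary: near every boundary point `x₀` there are a unit vector `ν` and a
Lipschitz function `γ` on the hyperplane `νᗮ` such that, in a ball around `x₀`, the set `Ω` is
the part strictly above the graph of `γ` in direction `ν`. -/
def HasLipschitzBoundary {d : ℕ} (Ω : Set (EuclideanSpace ℝ (Fin d))) : Prop :=
  ∀ x₀ ∈ frontier Ω, ∃ (ν : EuclideanSpace ℝ (Fin d)) (γ : (ℝ ∙ ν)ᗮ → ℝ) (K : NNReal) (r : ℝ),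
    ‖ν‖ = 1 ∧ LipschitzWith K γ ∧ 0 < r ∧
      ∀ x ∈ Metric.ball x₀ r, x ∈ Ω ↔ γ ((ℝ ∙ ν)ᗮ.orthogonalProjectionOnto x) < ⟪ν, x⟫_ℝ

/-- A bounded Lipschitz domain: a bounded, open, connected (so nonempty) set with Lipschitz
boundary. -/
structure IsBoundedLipschitzDomain {d : ℕ} (Ω : Set (EuclideanSpace ℝ (Fin d))) : Prop where
  isOpen : IsOpen Ω
  isConnected : IsConnected Ω
  isBounded : Bornology.IsBounded Ω
  lipschitz : HasLipschitzBoundary Ω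

/-! ### The Sobolev space `H¹(Ω)` and the Neumann Laplacian -/

/-- `L²(Ω)`, real valued. -/
abbrev L2 {d : ℕ} (Ω : Set (EuclideanSpace ℝ (Fin d))) : Type :=
  Lp ℝ 2 (volume.restrict Ω)

/-- `L²(Ω; ℝᵈ)`. -/
abbrev L2Vec {d : ℕ} (Ω : Set (EuclideanSpace ℝ (Fin d))) : Type :=
  Lp (EuclideanSpace ℝ (Fin d)) 2 (volume.restrict Ω)

/-- `g ∈ L²(Ω; ℝᵈ)` is the weak gradient of `u ∈ L²(Ω)`. The space `H¹(Ω)` consists of those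
`u ∈ L²(Ω)` that have such a `g`. -/
def IsWeakGradient {d : ℕ} (Ω : Set (EuclideanSpace ℝ (Fin d))) (u : L2 Ω) (g : L2Vec Ω) : Prop :=
  ∀ φ : EuclideanSpace ℝ (Fin d) → ℝ, ContDiff ℝ ∞ φ → HasCompactSupport φ → tsupport φ ⊆ Ω →
    ∀ i : Fin d,
      ∫ x in Ω, u x * fderiv ℝ φ x (EuclideanSpace.single i 1) = - ∫ x in Ω, g x i * φ x

/-- `u` lies in the domain of the Neumann Laplacian and `-Δ_N u = w`: `u ∈ H¹(Ω)`, `w ∈ L²(Ω)` and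
`∫_Ω w v = ∫_Ω ∇u · ∇v` for all `v ∈ H¹(Ω)`. -/
def IsNegNeumannLaplacian {d : ℕ} (Ω : Set (EuclideanSpace ℝ (Fin d))) (u w : L2 Ω) : Prop :=
  ∃ g : L2Vec Ω, IsWeakGradient Ω u g ∧
    ∀ (v : L2 Ω) (h : L2Vec Ω), IsWeakGradient Ω v h →
      ∫ x in Ω, w x * v x = ∫ x in Ω, ⟪g x, h x⟫_ℝ

/-- An orthonormal (Hilbert) basis `ψ₀, ψ₁, …` of `L²(Ω)` made of eigenfunctions of the Neumann
Laplacian, with eigenvalues `0 = λ₀ < λ₁ ≤ λ₂ ≤ …` tending to `+∞`. -/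
structure NeumannEigenbasis {d : ℕ} (Ω : Set (EuclideanSpace ℝ (Fin d))) where
  /-- the eigenfunctions `ψ₀, ψ₁, …` -/
  ψ : HilbertBasis ℕ ℝ (L2 Ω)
  /-- the eigenvalues `λ₀, λ₁, …` -/
  eig : ℕ → ℝ
  isEigen : ∀ k, IsNegNeumannLaplacian Ω (ψ k) (eig k • ψ k)
  eig_zero : eig 0 = 0
  eig_one_pos : 0 < eig 1
  eig_mono : Monotone eig
  eig_tendsto : Tendsto eig atTop atTop

namespace NeumannEigenbasis

variable {d : ℕ} {Ω : Set (EuclideanSpace ℝ (Fin d))}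

theorem eig_succ_pos (B : NeumannEigenbasis Ω) (k : ℕ) : 0 < B.eig (k + 1) :=
  B.eig_one_pos.trans_le (B.eig_mono (by omega))

/-- The coefficient `u_k = ∫_Ω u ψ_k`, as an `L²(Ω)` inner product. -/
def coeff (B : NeumannEigenbasis Ω) (u : L2 Ω) (k : ℕ) : ℝ := ⟪B.ψ k, u⟫_ℝ

theorem coeff_eq_integral (B : NeumannEigenbasis Ω) (u : L2 Ω) (k : ℕ) :
    B.coeff u k = ∫ x in Ω, u x * B.ψ k x := by
  simp [coeff, L2.inner_def]

theorem coeff_add (B : NeumannEigenbasis Ω) (u v : L2 Ω) (k : ℕ) :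
    B.coeff (u + v) k = B.coeff u k + B.coeff v k := inner_add_right _ _ _

theorem coeff_smul (B : NeumannEigenbasis Ω) (c : ℝ) (u : L2 Ω) (k : ℕ) :
    B.coeff (c • u) k = c * B.coeff u k := inner_smul_right _ _ _

theorem coeff_zero (B : NeumannEigenbasis Ω) (k : ℕ) : B.coeff 0 k = 0 := inner_zero_right _

/-! ### The space `ℍˢ_*(Ω)` and its dual -/

/-- Membership in `ℍˢ_*(Ω)`: `u` has zero integral, `u = ∑_{k ≥ 1} u_k ψ_k` in `L²(Ω)`, and
`∑_{k ≥ 1} λ_kˢ u_k² < ∞`. (Sums over `k ≥ 1` are written with `k + 1`, `k ≥ 0`. Integrability is automatic for bounded `Ω`.) -/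
structure MemHStar (B : NeumannEigenbasis Ω) (s : ℝ) (u : L2 Ω) : Prop where
  integrable : Integrable u (volume.restrict Ω)
  integral_eq_zero : ∫ x in Ω, u x = 0
  hasSum : HasSum (fun k : ℕ => B.coeff u (k + 1) • B.ψ (k + 1)) u
  summable : Summable fun k : ℕ => B.eig (k + 1) ^ s * B.coeff u (k + 1) ^ 2

theorem summable_mul (B : NeumannEigenbasis Ω) {s : ℝ} {u v : L2 Ω}
    (hu : Summable fun k : ℕ => B.eig (k + 1) ^ s * B.coeff u (k + 1) ^ 2)
    (hv : Summable fun k : ℕ => B.eig (k + 1) ^ s * B.coeff v (k + 1) ^ 2) :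
    Summable fun k : ℕ => B.eig (k + 1) ^ s * (B.coeff u (k + 1) * B.coeff v (k + 1)) := by
  refine Summable.of_norm_bounded (hu.add hv) fun k => ?_
  have h0 : 0 ≤ B.eig (k + 1) ^ s := Real.rpow_nonneg (B.eig_succ_pos k).le s
  rw [Real.norm_eq_abs, abs_mul, abs_of_nonneg h0, ← mul_add]
  refine mul_le_mul_of_nonneg_left (abs_le.2 ⟨?_, ?_⟩) h0 <;>
    nlinarith [sq_nonneg (B.coeff u (k + 1) + B.coeff v (k + 1)),
      sq_nonneg (B.coeff u (k + 1) - B.coeff v (k + 1)),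
      sq_nonneg (B.coeff u (k + 1)), sq_nonneg (B.coeff v (k + 1))]

/-- `ℍˢ_*(Ω)` as a linear subspace of `L²(Ω)`. -/
def hStarSubmodule (B : NeumannEigenbasis Ω) (s : ℝ) : Submodule ℝ (L2 Ω) where
  carrier := {u | B.MemHStar s u}
  zero_mem' :=
    { integrable := (integrable_congr (Lp.coeFn_zero ℝ 2 (volume.restrict Ω))).2
        (integrable_zero _ _ _)
      integral_eq_zero := by
        rw [integral_congr_ae (Lp.coeFn_zero ℝ 2 (volume.restrict Ω))]; simp
      hasSum := by simp [coeff_zero]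
      summable := by simp [coeff_zero] }
  add_mem' := by
    rintro u v hu hv
    refine ⟨?_, ?_, ?_, ?_⟩
    · exact (integrable_congr (Lp.coeFn_add u v)).2 (hu.integrable.add hv.integrable)
    · rw [integral_congr_ae (Lp.coeFn_add u v)]
      simp only [Pi.add_apply]
      rw [integral_add hu.integrable hv.integrable, hu.integral_eq_zero, hv.integral_eq_zero,
        add_zero]
    · simpa [coeff_add, add_smul] using hu.hasSum.add hv.hasSum
    · refine ((hu.summable.add hv.summable).add
        ((B.summable_mul hu.summable hv.summable).mul_left 2)).congr fun k => ?_
      rw [coeff_add]; ring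
  smul_mem' := by
    rintro c u hu
    refine ⟨?_, ?_, ?_, ?_⟩
    · exact (integrable_congr (Lp.coeFn_smul c u)).2 (hu.integrable.smul c)
    · rw [integral_congr_ae (Lp.coeFn_smul c u)]
      simp only [Pi.smul_apply]
      rw [integral_smul, hu.integral_eq_zero, smul_zero]
    · simpa [coeff_smul, mul_smul] using hu.hasSum.const_smul c
    · refine (hu.summable.mul_left (c ^ 2)).congr fun k => ?_
      rw [coeff_smul]; ring

/-- The space `ℍˢ_*(Ω)`, as a type of its own: it carries the norm
`‖u‖² = ∑_{k ≥ 1} λ_kˢ u_k²`, not that of `L²(Ω)`. -/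
def HStar (B : NeumannEigenbasis Ω) (s : ℝ) : Type := B.hStarSubmodule s

namespace HStar

variable {B : NeumannEigenbasis Ω} {s : ℝ}

instance : AddCommGroup (HStar B s) := inferInstanceAs (AddCommGroup (B.hStarSubmodule s))

instance : Module ℝ (HStar B s) := inferInstanceAs (Module ℝ (B.hStarSubmodule s))

/-- The inclusion `ℍˢ_*(Ω) → L²(Ω)`. -/
def toL2 : HStar B s →ₗ[ℝ] L2 Ω := (B.hStarSubmodule s).subtype

theorem toL2_injective : Function.Injective (toL2 : HStar B s → L2 Ω) :=
  (B.hStarSubmodule s).injective_subtype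

theorem memHStar (u : HStar B s) : B.MemHStar s (toL2 u) := u.2

/-- The inner product `∑_{k ≥ 1} λ_kˢ u_k v_k` on `ℍˢ_*(Ω)`. -/
@[reducible] def innerCore (B : NeumannEigenbasis Ω) (s : ℝ) : InnerProductSpace.Core ℝ (HStar B s) where
  inner u v := ∑' k : ℕ, B.eig (k + 1) ^ s *
    (B.coeff (toL2 u) (k + 1) * B.coeff (toL2 v) (k + 1))
  conj_inner_symm u v := by
    simp only [conj_trivial]
    exact tsum_congr fun k => by ring
  re_inner_nonneg u := by
    simp only [RCLike.re_to_real]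
    exact tsum_nonneg fun k =>
      mul_nonneg (Real.rpow_nonneg (B.eig_succ_pos k).le s) (mul_self_nonneg _)
  add_left u v w := by
    rw [← Summable.tsum_add (B.summable_mul u.memHStar.summable w.memHStar.summable)
      (B.summable_mul v.memHStar.summable w.memHStar.summable)]
    exact tsum_congr fun k => by rw [map_add, coeff_add]; ring
  smul_left u v r := by
    simp only [conj_trivial]
    rw [← tsum_mul_left]
    exact tsum_congr fun k => by rw [map_smul, coeff_smul]; ring
  definite u hu := by
    have hs := B.summable_mul u.memHStar.summable u.memHStar.summable
    have hn : ∀ k : ℕ, 0 ≤ B.eig (k + 1) ^ s *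
        (B.coeff (toL2 u) (k + 1) * B.coeff (toL2 u) (k + 1)) := fun k =>
      mul_nonneg (Real.rpow_nonneg (B.eig_succ_pos k).le s) (mul_self_nonneg _)
    have h0 := (hasSum_zero_iff_of_nonneg hn).1 (hu ▸ hs.hasSum)
    have hc : ∀ k : ℕ, B.coeff (toL2 u) (k + 1) = 0 := fun k => by
      have := congrFun h0 k
      simpa [(Real.rpow_pos_of_pos (B.eig_succ_pos k) s).ne'] using this
    have h1 := u.memHStar.hasSum
    simp only [hc, zero_smul] at h1
    exact toL2_injective ((h1.unique hasSum_zero).trans (map_zero toL2).symm)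

instance : NormedAddCommGroup (HStar B s) := (innerCore B s).toNormedAddCommGroup

instance : InnerProductSpace ℝ (HStar B s) := InnerProductSpace.ofCore (innerCore B s).toCore

theorem inner_eq (u v : HStar B s) :
    ⟪u, v⟫_ℝ = ∑' k : ℕ, B.eig (k + 1) ^ s *
      (B.coeff (toL2 u) (k + 1) * B.coeff (toL2 v) (k + 1)) := rfl

theorem norm_sq_eq (u : HStar B s) :
    ‖u‖ ^ 2 = ∑' k : ℕ, B.eig (k + 1) ^ s * B.coeff (toL2 u) (k + 1) ^ 2 := by
  rw [← real_inner_self_eq_norm_sq, inner_eq]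
  exact tsum_congr fun k => by ring

end HStar

/-- The space `ℍ⁻ˢ_*(Ω)`: the dual space of `ℍˢ_*(Ω)`, with the dual norm. -/
abbrev HStarDual (B : NeumannEigenbasis Ω) (s : ℝ) : Type := StrongDual ℝ (HStar B s)

/-! ### Fractional powers and weak solutions -/

/-- `(-Δ_N)^σ u = ∑_{k ≥ 1} λ_k^σ u_k ψ_k`, with the series taken in `L²(Ω)`. It converges there when
`u ∈ ℍ^{2σ}_*(Ω)`, see `hasSum_fracPow`. -/
def fracPow (B : NeumannEigenbasis Ω) (σ : ℝ) (u : L2 Ω) : L2 Ω :=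
  ∑' k : ℕ, (B.eig (k + 1) ^ σ * B.coeff u (k + 1)) • B.ψ (k + 1)

theorem hasSum_fracPow (B : NeumannEigenbasis Ω) {s : ℝ} {u : L2 Ω} (hu : B.MemHStar s u) :
    HasSum (fun k : ℕ => (B.eig (k + 1) ^ (s / 2) * B.coeff u (k + 1)) • B.ψ (k + 1))
      (B.fracPow (s / 2) u) := by
  have ho : Orthonormal ℝ fun k : ℕ => B.ψ (k + 1) :=
    B.ψ.orthonormal.comp _ (add_left_injective 1)
  refine Summable.hasSum ?_
  have := (ho.orthogonalFamily.summable_iff_norm_sq_summable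
    (fun k : ℕ => B.eig (k + 1) ^ (s / 2) * B.coeff u (k + 1))).2 (hu.summable.congr fun k => ?_)
  · simpa [LinearIsometry.toSpanSingleton_apply] using this
  · rw [Real.norm_eq_abs, sq_abs, mul_pow, ← Real.rpow_natCast (B.eig (k + 1) ^ (s / 2)),
      ← Real.rpow_mul (B.eig_succ_pos k).le]
    norm_num

/-- `u ∈ ℍˢ_*(Ω)` is a weak solution of `(-Δ_N)ˢ u = f` for `f ∈ ℍ⁻ˢ_*(Ω)`. -/
def IsWeakSolution (B : NeumannEigenbasis Ω) {s : ℝ} (f : HStarDual B s) (u : HStar B s) : Prop :=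
  ∀ v : HStar B s,
    ∫ x in Ω, B.fracPow (s / 2) (HStar.toL2 u) x * B.fracPow (s / 2) (HStar.toL2 v) x = f v

end NeumannEigenbasis

end FracNeumann

end

noncomputable section

namespace FracNeumann

section

variable {d : ℕ} {Ω : Set (EuclideanSpace ℝ (Fin d))}

/-! ### Weak gradients of smooth functions -/

/-! Eigenbasis. Let `J` be the inclusion of `H¹(Ω)`, the closed graph of the weak gradient, into
`L²(Ω)`. Then `J J*` is `(1 - Δ_N)⁻¹`: it is symmetric, and positive definite because the range of
`J` contains the test functions. If `J` is compact, the spectral theorem gives a Hilbert basis with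
`J J* ψ = μ ψ`, and the Neumann eigenvalues are `μ⁻¹ - 1`. Testing with the constant `1` forces `λ₀
= 0`; on a connected set only constants have zero gradient, so `λ₁ > 0`.

Compactness of `J` is proved without an extension theorem. Near each point of the closure, Ω
contains a fixed cone with vertex at every nearby point of Ω (`exists_uniformCone`). Replacing `u`
on small cells by its mean over a ball displaced along the cone is a finite-rank operation, and by
`lintegral_translate_sub_sq_le` its error is a small multiple of the gradient norm. Finitely many
such regions cover Ω (`hasCompactApprox_self`), so `J` is a norm limit of compact operators.

Weak solutions. By Parseval, `(-Δ_N)^{s/2}` is an isometry of `ℍˢ_*` onto the closed subspace `ψ₀ᗮ`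
of `L²` (`range_fracPowIsometry`). Hence `ℍˢ_*` is a Hilbert space whose inner product is the weak
form, and Riesz representation gives existence, uniqueness and the bound. -/

theorem inner_eq_integral_mul (u v : L2 Ω) : ⟪u, v⟫_ℝ = ∫ x in Ω, v x * u x := by
  simp [L2.inner_def]

/-- Both integrands vanish off Ω, so this is integration by parts on the whole space; no regularity
of Ω is involved. -/
theorem setIntegral_mul_fderiv_eq_neg {f φ : EuclideanSpace ℝ (Fin d) → ℝ} (hf : ContDiff ℝ ∞ f)
    (hφ : ContDiff ℝ ∞ φ) (hc : HasCompactSupport φ) (hs : tsupport φ ⊆ Ω)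
    (e : EuclideanSpace ℝ (Fin d)) :
    ∫ x in Ω, f x * fderiv ℝ φ x e = - ∫ x in Ω, fderiv ℝ f x e * φ x := by
  have hdφ : Continuous fun x => fderiv ℝ φ x e :=
    (hφ.continuous_fderiv (by simp)).clm_apply continuous_const
  have hdf : Continuous fun x => fderiv ℝ f x e :=
    (hf.continuous_fderiv (by simp)).clm_apply continuous_const
  have hcd : HasCompactSupport fun x => fderiv ℝ φ x e := hc.fderiv_apply ℝ e
  rw [setIntegral_eq_integral_of_forall_compl_eq_zero,
    setIntegral_eq_integral_of_forall_compl_eq_zero]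
  · refine integral_mul_fderiv_eq_neg_fderiv_mul_of_integrable ?_ ?_ ?_
      (fun x _ => hf.differentiable (by simp) x) (fun x _ => hφ.differentiable (by simp) x)
    · exact (hdf.mul hφ.continuous).integrable_of_hasCompactSupport hc.mul_left
    · exact (hf.continuous.mul hdφ).integrable_of_hasCompactSupport hcd.mul_left
    · exact (hf.continuous.mul hφ.continuous).integrable_of_hasCompactSupport hc.mul_left
  · intro x hx
    rw [image_eq_zero_of_notMem_tsupport fun h => hx (hs h), mul_zero]
  · intro x hx
    rw [image_eq_zero_of_notMem_tsupport
      (f := fun x => fderiv ℝ φ x e) fun h => hx (hs (tsupport_fderiv_apply_subset ℝ e h)), mul_zero]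

/-- The constant function `1` in `L²(Ω)`. -/
def oneL2 (Ω : Set (EuclideanSpace ℝ (Fin d))) [IsFiniteMeasure (volume.restrict Ω)] : L2 Ω :=
  indicatorConstLp 2 MeasurableSet.univ (measure_ne_top _ _) 1

theorem oneL2_coeFn [IsFiniteMeasure (volume.restrict Ω)] :
    oneL2 Ω =ᵐ[volume.restrict Ω] fun _ => 1 := by
  filter_upwards [indicatorConstLp_coeFn (p := 2) (hs := MeasurableSet.univ)
    (hμs := measure_ne_top (volume.restrict Ω) _) (c := (1 : ℝ))] with x hx
  simpa [oneL2] using hx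

theorem inner_oneL2 [IsFiniteMeasure (volume.restrict Ω)] (u : L2 Ω) :
    ⟪oneL2 Ω, u⟫_ℝ = ∫ x in Ω, u x := by
  rw [oneL2, L2.inner_indicatorConstLp_one, Measure.restrict_univ]

/-- Makes the constant `1` admissible in the Neumann weak form, which yields the zero mean of every
`-Δ_N u`. -/
theorem isWeakGradient_oneL2 [IsFiniteMeasure (volume.restrict Ω)] :
    IsWeakGradient Ω (oneL2 Ω) 0 := by
  intro φ hφ hc hs i
  have h1 : ∫ x in Ω, oneL2 Ω x * fderiv ℝ φ x (EuclideanSpace.single i 1)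
      = ∫ x in Ω, (1 : ℝ) * fderiv ℝ φ x (EuclideanSpace.single i 1) :=
    integral_congr_ae (by filter_upwards [oneL2_coeFn (Ω := Ω)] with x hx; rw [hx])
  have h2 : ∫ x in Ω, (0 : L2Vec Ω) x i * φ x = 0 := by
    refine (integral_congr_ae (g := fun _ => 0) ?_).trans (by simp)
    filter_upwards [Lp.coeFn_zero (EuclideanSpace ℝ (Fin d)) 2 (volume.restrict Ω)] with x hx
    rw [hx]
    simp
  rw [h1, h2, setIntegral_mul_fderiv_eq_neg (f := fun _ => 1) contDiff_const hφ hc hs]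
  simp

/-! ### The space `ℍˢ_*(Ω)` -/

namespace NeumannEigenbasis

variable (B : NeumannEigenbasis Ω) {s : ℝ}

theorem coeff_of_hasSum {a : ℕ → ℝ} {w : L2 Ω}
    (h : HasSum (fun k => a k • B.ψ (k + 1)) w) :
    B.coeff w 0 = 0 ∧ ∀ k, B.coeff w (k + 1) = a k := by
  have key : ∀ i, HasSum (fun k => a k * ⟪B.ψ i, B.ψ (k + 1)⟫_ℝ) (B.coeff w i) := fun i => by
    simpa [coeff, inner_smul_right] using h.mapL (innerSL ℝ (B.ψ i))
  have ho := orthonormal_iff_ite.1 B.ψ.orthonormal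
  constructor
  · refine (key 0).unique ?_
    simp [ho, hasSum_zero]
  · intro k
    refine (key (k + 1)).unique ?_
    convert hasSum_ite_eq k (a k) using 2 with j
    rcases eq_or_ne j k with rfl | hj
    · rw [ho, if_pos rfl, if_pos rfl, mul_one]
    · simp [ho, hj, hj.symm]

theorem hasSum_of_coeff_zero {w : L2 Ω} (h : B.coeff w 0 = 0) :
    HasSum (fun k : ℕ => B.coeff w (k + 1) • B.ψ (k + 1)) w := by
  have := (hasSum_nat_add_iff' 1).2 (B.ψ.hasSum_repr w)
  simp only [HilbertBasis.repr_apply_apply, Finset.range_one, Finset.sum_singleton] at this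
  rw [show ⟪B.ψ 0, w⟫_ℝ = 0 from h, zero_smul, sub_zero] at this
  exact this

theorem summable_coeff_sq (w : L2 Ω) : Summable fun k => B.coeff w k ^ 2 := by
  refine (B.ψ.summable_inner_mul_inner w w).congr fun k => ?_
  rw [real_inner_comm, coeff, sq]

theorem exists_coeff_eq {a : ℕ → ℝ} (ha : Summable fun k => a k ^ 2) :
    ∃ w : L2 Ω, ∀ k, B.coeff w k = a k := by
  have hm : Memℓp a 2 := by
    refine memℓp_gen ?_
    simpa using ha
  refine ⟨B.ψ.repr.symm ⟨a, hm⟩, fun k => ?_⟩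
  rw [coeff, ← HilbertBasis.repr_apply_apply, LinearIsometryEquiv.apply_symm_apply]

/-- Testing the eigenvalue equation with `1` gives `λ ∫ ψ = 0`, and `λ > 0` from index one on. -/
theorem inner_eigenfunction_oneL2 [IsFiniteMeasure (volume.restrict Ω)] (k : ℕ) :
    ⟪oneL2 Ω, B.ψ (k + 1)⟫_ℝ = 0 := by
  obtain ⟨g, -, h⟩ := B.isEigen (k + 1)
  have h1 := h _ _ (isWeakGradient_oneL2 (Ω := Ω))
  rw [← inner_eq_integral_mul, ← L2.inner_def (𝕜 := ℝ), inner_zero_right, inner_smul_right] at h1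
  exact (mul_eq_zero.1 h1).resolve_left (B.eig_succ_pos k).ne'

/-- Without a `ψ₀` term, `u` is an `L²` sum of eigenfunctions of zero mean, so its own mean is zero.
-/
theorem memHStar_of_coeff [IsFiniteMeasure (volume.restrict Ω)] {u : L2 Ω} (h0 : B.coeff u 0 = 0)
    (hs : Summable fun k : ℕ => B.eig (k + 1) ^ s * B.coeff u (k + 1) ^ 2) : B.MemHStar s u where
  integrable := (Lp.memLp u).integrable (by norm_num)
  integral_eq_zero := by
    rw [← inner_oneL2]
    have := (B.hasSum_of_coeff_zero h0).mapL (innerSL ℝ (oneL2 Ω))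
    simp only [map_smul, innerSL_apply_apply, B.inner_eigenfunction_oneL2, smul_zero] at this
    exact this.unique hasSum_zero
  hasSum := B.hasSum_of_coeff_zero h0
  summable := hs

namespace HStar

variable {B}

theorem coeff_fracPow (u : HStar B s) : B.coeff (B.fracPow (s / 2) (toL2 u)) 0 = 0 ∧
    ∀ k, B.coeff (B.fracPow (s / 2) (toL2 u)) (k + 1)
      = B.eig (k + 1) ^ (s / 2) * B.coeff (toL2 u) (k + 1) :=
  B.coeff_of_hasSum (B.hasSum_fracPow u.memHStar)

/-- `(-Δ_N)^{s/2}` as a linear map `ℍˢ_*(Ω) → L²(Ω)`. -/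
def fracPowLinear (B : NeumannEigenbasis Ω) (s : ℝ) : HStar B s →ₗ[ℝ] L2 Ω where
  toFun u := B.fracPow (s / 2) (toL2 u)
  map_add' u v := by
    refine (B.hasSum_fracPow (u + v).memHStar).unique ?_
    convert (B.hasSum_fracPow u.memHStar).add (B.hasSum_fracPow v.memHStar) using 2 with k
    rw [map_add, coeff_add, mul_add, add_smul]
  map_smul' c u := by
    refine (B.hasSum_fracPow (c • u).memHStar).unique ?_
    convert (B.hasSum_fracPow u.memHStar).const_smul c using 2 with k
    rw [map_smul, coeff_smul, smul_smul, mul_left_comm]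
    rfl

theorem eig_rpow_half_mul_self (B : NeumannEigenbasis Ω) (k : ℕ) (s : ℝ) :
    B.eig (k + 1) ^ (s / 2) * B.eig (k + 1) ^ (s / 2) = B.eig (k + 1) ^ s := by
  rw [← Real.rpow_add (B.eig_succ_pos k), add_halves]

/-- Parseval: the `ψ₀` term drops out, and the two factors `λ^{s/2}` combine to the weight `λˢ`. -/
theorem inner_fracPow (u v : HStar B s) :
    ⟪B.fracPow (s / 2) (toL2 u), B.fracPow (s / 2) (toL2 v)⟫_ℝ = ⟪u, v⟫_ℝ := by
  have h := (hasSum_nat_add_iff' 1).2 (B.ψ.hasSum_inner_mul_inner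
    (B.fracPow (s / 2) (toL2 u)) (B.fracPow (s / 2) (toL2 v)))
  simp only [Finset.range_one, Finset.sum_singleton] at h
  rw [inner_eq, ← sub_zero ⟪B.fracPow (s / 2) (toL2 u), B.fracPow (s / 2) (toL2 v)⟫_ℝ]
  have h0 := (coeff_fracPow u).1
  rw [coeff, real_inner_comm] at h0
  rw [h0, zero_mul] at h
  rw [← h.tsum_eq]
  refine tsum_congr fun k => ?_
  rw [real_inner_comm, ← coeff, ← coeff, (coeff_fracPow u).2, (coeff_fracPow v).2,
    ← eig_rpow_half_mul_self B k s]
  ring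

/-- `(-Δ_N)^{s/2}` as a linear isometry `ℍˢ_*(Ω) → L²(Ω)`. -/
def fracPowIsometry (B : NeumannEigenbasis Ω) (s : ℝ) : HStar B s →ₗᵢ[ℝ] L2 Ω :=
  (fracPowLinear B s).isometryOfInner inner_fracPow

/-- The preimage of `w` has coefficients `λ_k^{-s/2} w_k`. Since `s ≥ 0`, these multipliers are at
most `λ₁^{-s/2}`, so the preimage does lie in `L²`. -/
theorem range_fracPowIsometry [IsFiniteMeasure (volume.restrict Ω)] (hs : 0 ≤ s) :
    Set.range (fracPowIsometry B s) = {w | B.coeff w 0 = 0} := by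
  refine Set.Subset.antisymm (Set.range_subset_iff.2 fun u => (coeff_fracPow u).1) fun w hw => ?_
  have h1 := (B.summable_coeff_sq w).comp_injective (add_left_injective 1)
  have hpos := fun k => Real.rpow_pos_of_pos (B.eig_succ_pos k) (s / 2)
  -- Index `0` is set apart: its coefficient must vanish for `u` to belong to `ℍˢ_*`.
  obtain ⟨u, hu⟩ := B.exists_coeff_eq
    (a := fun k => if k = 0 then 0 else (B.eig k ^ (s / 2))⁻¹ * B.coeff w k) (by
      refine (summable_nat_add_iff 1).1 (Summable.of_nonneg_of_le (fun _ => sq_nonneg _)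
        (fun k => ?_) (h1.mul_left (((B.eig 1 ^ (s / 2))⁻¹) ^ 2)))
      rw [if_neg k.succ_ne_zero, mul_pow]
      refine mul_le_mul_of_nonneg_right (pow_le_pow_left₀ (inv_nonneg.2 (hpos k).le) ?_ 2)
        (sq_nonneg _)
      exact inv_anti₀ (hpos 0) (Real.rpow_le_rpow B.eig_one_pos.le (B.eig_mono (by omega))
        (by positivity)))
  have hmem : B.MemHStar s u := by
    refine B.memHStar_of_coeff (by simp [hu]) (h1.congr fun k => ?_)
    rw [hu, if_neg k.succ_ne_zero, ← eig_rpow_half_mul_self, Function.comp]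
    field_simp [(hpos k).ne']
  refine ⟨(⟨u, hmem⟩ : B.hStarSubmodule s), ?_⟩
  refine (B.hasSum_fracPow hmem).unique ?_
  convert B.hasSum_of_coeff_zero hw using 3 with k
  rw [hu, if_neg k.succ_ne_zero, mul_inv_cancel_left₀ (hpos k).ne']

theorem completeSpace [IsFiniteMeasure (volume.restrict Ω)] (hs : 0 ≤ s) :
    CompleteSpace (HStar B s) := by
  rw [completeSpace_iff_isComplete_range (fracPowIsometry B s).isometry.isUniformInducing,
    range_fracPowIsometry hs]
  exact (isClosed_eq (continuous_const.inner continuous_id) continuous_const).isComplete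

end HStar

/-! ### Weak solutions by Riesz representation -/

theorem isWeakSolution_iff (f : HStarDual B s) (u : HStar B s) :
    B.IsWeakSolution f u ↔ ∀ v, ⟪u, v⟫_ℝ = f v := by
  refine forall_congr' fun v => ?_
  rw [← inner_eq_integral_mul, HStar.inner_fracPow, real_inner_comm]

/-- The solution is the Riesz representative of `f`, so the norm bound is in fact an equality. -/
theorem exists_unique_isWeakSolution [IsFiniteMeasure (volume.restrict Ω)] (hs : 0 ≤ s)
    (f : HStarDual B s) :
    ∃ u : HStar B s, B.IsWeakSolution f u ∧ (∀ w, B.IsWeakSolution f w → w = u) ∧ ‖u‖ ≤ ‖f‖ := by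
  have := HStar.completeSpace (B := B) hs
  refine ⟨(InnerProductSpace.toDual ℝ _).symm f, ?_, fun w hw => ?_,
    ((InnerProductSpace.toDual ℝ _).symm.norm_map f).le⟩
  · exact (B.isWeakSolution_iff f _).2 fun v => InnerProductSpace.toDual_symm_apply
  · refine ext_inner_right ℝ fun v => ?_
    rw [(B.isWeakSolution_iff f w).1 hw, InnerProductSpace.toDual_symm_apply]

end NeumannEigenbasis

end

section

/-! ### Ordered eigenbases of compact positive operators -/

/-- Order `I` by `f`, breaking ties by an injection into `ℕ`. Initial segments are finite, so `i ↦
#{j < i}` embeds `I` as an infinite subset of `ℕ`, and such a subset is order isomorphic to `ℕ`. -/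
theorem exists_equiv_nat_monotone {I : Type*} [Infinite I] (f : I → ℝ)
    (hf : ∀ c, {i | f i ≤ c}.Finite) : ∃ e : ℕ ≃ I, Monotone (f ∘ e) := by
  have hcount : Countable I := by
    rw [← Set.countable_univ_iff]
    have : (Set.univ : Set I) = ⋃ n : ℕ, {i | f i ≤ n} := by
      ext i
      simpa using exists_nat_ge (f i)
    rw [this]
    exact Set.countable_iUnion fun n => (hf n).countable
  obtain ⟨code, hcode⟩ := exists_injective_nat I
  let : LinearOrder I := LinearOrder.lift' (fun i => toLex (f i, code i)) fun i j h =>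
    hcode (congrArg Prod.snd (toLex_inj.1 h))
  have hmono : Monotone f := fun i j h => by
    rcases (Prod.Lex.le_iff (x := toLex (f i, code i)) (y := toLex (f j, code j))).1 h with h | h
    · exact h.le
    · exact h.1.le
  have hfin : ∀ i : I, (Set.Iio i).Finite := fun i =>
    (hf (f i)).subset fun j hj => hmono (le_of_lt hj)
  have hr : StrictMono fun i : I => (Set.Iio i).ncard := fun i j hij =>
    Set.ncard_lt_ncard (Set.Iio_ssubset_Iio hij) (hfin j)
  have : Infinite (Set.range fun i : I => (Set.Iio i).ncard) :=
    (Set.infinite_range_of_injective hr.injective).to_subtype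
  classical
  let e : ℕ ≃o I := (Nat.Subtype.orderIsoOfNat _).trans (hr.orderIso _).symm
  exact ⟨e.toEquiv, hmono.comp e.monotone⟩

variable {E : Type*} [NormedAddCommGroup E] [InnerProductSpace ℝ E]

/-- For distinct indices `‖T vᵢ - T vⱼ‖² = μᵢ² + μⱼ²`. Infinitely many `μᵢ ≥ ε` would give images of
unit vectors that are `ε`-separated, against compactness. -/
theorem finite_setOf_le_eigenvalue {T : E →L[ℝ] E} (hT : IsCompactOperator T) {I : Type*}
    {v : I → E} (hv : Orthonormal ℝ v) {μ : I → ℝ} (hμ : ∀ i, T (v i) = μ i • v i) {ε : ℝ}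
    (hε : 0 < ε) : {i | ε ≤ μ i}.Finite := by
  by_contra hinf
  obtain ⟨K, hK, hsub⟩ :=
    IsCompactOperator.image_closedBall_subset_compact (f := T.toLinearMap) hT 1
  let n := Set.Infinite.natEmbedding _ hinf
  have hmem : ∀ k, T (v (n k)) ∈ K := fun k =>
    hsub ⟨v (n k), by simp [hv.norm_eq_one], rfl⟩
  obtain ⟨a, -, φ, hφ, hlim⟩ := hK.tendsto_subseq hmem
  obtain ⟨N, hN⟩ := Metric.cauchySeq_iff'.1 hlim.cauchySeq ε hε
  have h1 := hN (N + 1) (Nat.le_succ _)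
  set i : I := (n (φ (N + 1))).1
  set j : I := (n (φ N)).1
  have hij : i ≠ j := fun h => by
    have := hφ.injective (n.injective (Subtype.ext h))
    omega
  have h2 : ‖T (v i) - T (v j)‖ ^ 2 = μ i ^ 2 + μ j ^ 2 := by
    rw [hμ, hμ, @norm_sub_sq_real, inner_smul_left, inner_smul_right, hv.inner_eq_zero hij,
      norm_smul, norm_smul, hv.norm_eq_one, hv.norm_eq_one]
    simp
  have hi : ε ≤ μ i := (n (φ (N + 1))).2
  rw [Function.comp, Function.comp, dist_eq_norm] at h1
  nlinarith [norm_nonneg (T (v i) - T (v j)), sq_nonneg (μ j)]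

/-- A compact, symmetric, positive definite operator on an infinite-dimensional Hilbert space has a
Hilbert basis of eigenvectors whose eigenvalues decrease to `0`. -/
theorem exists_hilbertBasis_eigenvectors [CompleteSpace E] (hE : ¬ FiniteDimensional ℝ E)
    {T : E →L[ℝ] E} (hT : IsCompactOperator T) (hs : T.IsSymmetric)
    (hpos : ∀ x, x ≠ 0 → 0 < ⟪T x, x⟫_ℝ) :
    ∃ (b : HilbertBasis ℕ ℝ E) (μ : ℕ → ℝ), (∀ k, T (b k) = μ k • b k) ∧ (∀ k, 0 < μ k) ∧
      Antitone μ ∧ Tendsto μ atTop (𝓝 0) := by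
  let V : ℝ → Submodule ℝ E := fun μ => Module.End.eigenspace (T : Module.End ℝ E) μ
  have hV : ∀ {μ x}, x ∈ V μ → T x = μ • x := fun h => Module.End.mem_eigenspace_iff.1 h
  have hfd : ∀ μ, FiniteDimensional ℝ (V μ) := fun μ => by
    rcases eq_or_ne μ 0 with rfl | h
    · have : V 0 = ⊥ := by
        rw [eq_bot_iff]
        intro x hx
        by_contra h0
        have := hpos x h0
        rw [hV hx, zero_smul, inner_zero_left] at this
        exact this.false
      rw [this]
      infer_instance
    · exact T.finite_dimensional_eigenspace hT μ h
  -- An index is an eigenvalue with a basis vector of its eigenspace, so multiplicities are counted;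
  -- values that are not eigenvalues contribute nothing.
  let I := Σ μ : ℝ, Fin (Module.finrank ℝ (V μ))
  let v : I → E := fun i => (stdOrthonormalBasis ℝ (V i.1) i.2 : E)
  have hv : Orthonormal ℝ v :=
    hs.orthogonalFamily_eigenspaces.orthonormal_sigma_orthonormal
      (v_family := fun μ => stdOrthonormalBasis ℝ (V μ)) fun μ => (stdOrthonormalBasis ℝ _).orthonormal
  have heig : ∀ i, T (v i) = i.1 • v i := fun i => hV (Subtype.mem _)
  have hpos' : ∀ i : I, 0 < i.1 := fun i => by
    have := hpos (v i) (hv.ne_zero i)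
    rwa [heig, inner_smul_left, real_inner_self_eq_norm_sq, hv.norm_eq_one, conj_trivial, one_pow,
      mul_one] at this
  have hspan : ∀ μ, V μ ≤ Submodule.span ℝ (Set.range v) := fun μ x hx => by
    have h1 := (stdOrthonormalBasis ℝ (V μ)).sum_repr ⟨x, hx⟩
    have h2 := congrArg Subtype.val h1
    simp only [Submodule.coe_sum, Submodule.coe_smul] at h2
    rw [← h2]
    exact Submodule.sum_mem _ fun i _ => Submodule.smul_mem _ _ (Submodule.subset_span ⟨⟨μ, i⟩, rfl⟩)
  have hperp : (Submodule.span ℝ (Set.range v))ᗮ = ⊥ := by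
    rw [eq_bot_iff, ← T.orthogonalComplement_iSup_eigenspaces_eq_bot hT hs]
    exact Submodule.orthogonal_le (iSup_le hspan)
  have hinf : Infinite I := by
    by_contra hfin
    rw [not_infinite_iff_finite] at hfin
    have hf : FiniteDimensional ℝ (Submodule.span ℝ (Set.range v)) :=
      FiniteDimensional.span_of_finite ℝ (Set.finite_range v)
    have : Submodule.span ℝ (Set.range v) = ⊤ := Submodule.orthogonal_eq_bot_iff.1 hperp
    rw [this] at hf
    exact hE (Module.finite_def.2 (Module.Finite.iff_fg.1 hf))
  -- Sorting the reciprocals upwards sorts the eigenvalues downwards. The `max c 1` keeps the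
  -- threshold positive for every `c`.
  obtain ⟨e, he⟩ := exists_equiv_nat_monotone (fun i : I => i.1⁻¹) fun c => by
    refine (finite_setOf_le_eigenvalue hT hv heig (ε := (max c 1)⁻¹) (by positivity)).subset ?_
    intro i hi
    exact inv_le_of_inv_le₀ (hpos' i) (le_trans hi (le_max_left _ _))
  refine ⟨HilbertBasis.mkOfOrthogonalEqBot (hv.comp e e.injective) ?_, fun k => (e k).1, ?_,
    fun k => hpos' _, ?_, ?_⟩
  · rwa [EquivLike.range_comp]
  · intro k
    simp only [HilbertBasis.coe_mkOfOrthogonalEqBot]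
    exact heig _
  · intro k l hkl
    exact (inv_le_inv₀ (hpos' _) (hpos' _)).1 (he hkl)
  · rw [Metric.tendsto_atTop']
    intro ε hε
    have h1 : (e ⁻¹' {i : I | ε ≤ i.1}).Finite :=
      (finite_setOf_le_eigenvalue hT hv heig hε).preimage e.injective.injOn
    obtain ⟨N, hN⟩ := h1.bddAbove
    refine ⟨N, fun n hn => ?_⟩
    rw [Real.dist_eq, sub_zero, abs_of_pos (hpos' _)]
    by_contra! h
    exact absurd (hN h) (by omega)

end

section

variable {d : ℕ} {Ω V : Set (EuclideanSpace ℝ (Fin d))}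

/-! ### Test functions -/

theorem lintegral_enorm_sq_coeFn {α F : Type*} {_ : MeasurableSpace α} {μ : Measure α}
    [NormedAddCommGroup F] (f : Lp F 2 μ) :
    ∫⁻ x, ‖f x‖ₑ ^ 2 ∂μ = ENNReal.ofReal (‖f‖ ^ 2) := by
  have h := eLpNorm_nnreal_pow_eq_lintegral (f := f) (μ := μ) (p := 2) (by norm_num)
  simp only [NNReal.coe_ofNat, ENNReal.coe_ofNat, ENNReal.rpow_ofNat] at h
  rw [← h, ← Lp.enorm_def, ← ofReal_norm, ENNReal.ofReal_pow (norm_nonneg _)]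

/-- The elements of `L²(V)` represented by smooth functions with compact support in `V`. -/
def testSubmodule (V : Set (EuclideanSpace ℝ (Fin d))) : Submodule ℝ (L2 V) where
  carrier := {v | ∃ φ : EuclideanSpace ℝ (Fin d) → ℝ, ContDiff ℝ ∞ φ ∧ HasCompactSupport φ ∧
    tsupport φ ⊆ V ∧ v =ᵐ[volume.restrict V] φ}
  zero_mem' := ⟨0, contDiff_const, HasCompactSupport.zero, by simp [tsupport],
    Lp.coeFn_zero ℝ 2 (volume.restrict V)⟩
  add_mem' := by
    rintro v w ⟨φ, h1, h2, h3, h4⟩ ⟨χ, k1, k2, k3, k4⟩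
    exact ⟨φ + χ, h1.add k1, h2.add k2, (tsupport_add φ χ).trans (Set.union_subset h3 k3),
      (Lp.coeFn_add v w).trans (h4.add k4)⟩
  smul_mem' := by
    rintro c v ⟨φ, h1, h2, h3, h4⟩
    exact ⟨c • φ, h1.const_smul c, h2.smul_left (f := fun _ => c),
      (tsupport_smul_subset_right (fun _ => c) φ).trans h3,
      (Lp.coeFn_smul c v).trans (h4.const_smul c)⟩

theorem memLp_of_contDiff {φ : EuclideanSpace ℝ (Fin d) → ℝ} (h1 : ContDiff ℝ ∞ φ)
    (h2 : HasCompactSupport φ) (p : ℝ≥0∞) (μ : Measure (EuclideanSpace ℝ (Fin d)))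
    [IsFiniteMeasureOnCompacts μ] : MemLp φ p μ :=
  h1.continuous.memLp_of_hasCompactSupport h2

/-- The fundamental lemma of the calculus of variations. It gives density of test functions, and
later the injectivity of the adjoint of the inclusion. -/
theorem testSubmodule_orthogonal (hV : IsOpen V) [IsFiniteMeasure (volume.restrict V)] :
    (testSubmodule V)ᗮ = ⊥ := by
  rw [eq_bot_iff]
  intro w hw
  have hint : IntegrableOn w V := (Lp.memLp w).integrable (by norm_num)
  have h := hV.ae_eq_zero_of_integral_contDiff_smul_eq_zero (μ := volume) (f := w)
    hint.locallyIntegrableOn fun φ h1 h2 h3 => by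
      have hm := memLp_of_contDiff h1 h2 2 (volume.restrict V)
      have h4 := hw (hm.toLp φ) ⟨φ, h1, h2, h3, hm.coeFn_toLp⟩
      rw [inner_eq_integral_mul] at h4
      rw [← h4, ← setIntegral_eq_integral_of_forall_compl_eq_zero (s := V)]
      · refine integral_congr_ae ?_
        filter_upwards [hm.coeFn_toLp] with x hx
        rw [hx, smul_eq_mul, mul_comm]
      · intro x hx
        rw [image_eq_zero_of_notMem_tsupport fun h => hx (h3 h), zero_smul]
  refine Lp.ext_iff.2 (EventuallyEq.trans ?_ (Lp.coeFn_zero ℝ 2 (volume.restrict V)).symm)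
  exact (ae_restrict_iff' hV.measurableSet).2 h

theorem dense_testSubmodule (hV : IsOpen V) [IsFiniteMeasure (volume.restrict V)] :
    Dense (testSubmodule V : Set (L2 V)) := by
  rw [Submodule.dense_iff_topologicalClosure_eq_top,
    ← Submodule.orthogonal_eq_bot_iff (K := (testSubmodule V).topologicalClosure),
    Submodule.orthogonal_closure, testSubmodule_orthogonal hV]

/-- The `L²` norm is determined by pairings with test functions. -/
theorem norm_le_of_forall_test (hV : IsOpen V) [IsFiniteMeasure (volume.restrict V)] {w : L2 V}
    {C : ℝ} (hC : 0 ≤ C) (h : ∀ v ∈ testSubmodule V, ⟪w, v⟫_ℝ ≤ C * ‖v‖) : ‖w‖ ≤ C := by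
  have h1 : ∀ v, ⟪w, v⟫_ℝ ≤ C * ‖v‖ := fun v => by
    have hc : IsClosed {v : L2 V | ⟪w, v⟫_ℝ ≤ C * ‖v‖} :=
      isClosed_le (continuous_const.inner continuous_id) (continuous_const.mul continuous_norm)
    exact hc.closure_subset_iff.2 h (dense_testSubmodule hV v)
  have h2 := h1 w
  rw [real_inner_self_eq_norm_sq, sq] at h2
  rcases (norm_nonneg w).eq_or_lt with h0 | h0
  · rwa [← h0]
  · exact le_of_mul_le_mul_right h2 h0

end

section

variable {d : ℕ} {Ω V : Set (EuclideanSpace ℝ (Fin d))}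

/-! ### Translations of functions with a weak gradient -/

theorem IsWeakGradient.integral_mul_fderiv {u : L2 Ω} {g : L2Vec Ω}
    [IsFiniteMeasure (volume.restrict Ω)] (h : IsWeakGradient Ω u g)
    {φ : EuclideanSpace ℝ (Fin d) → ℝ} (h1 : ContDiff ℝ ∞ φ) (h2 : HasCompactSupport φ)
    (h3 : tsupport φ ⊆ Ω) (z : EuclideanSpace ℝ (Fin d)) :
    ∫ x in Ω, u x * fderiv ℝ φ x z = - ∫ x in Ω, ⟪g x, φ x • z⟫_ℝ := by
  have hz : z = ∑ i, z i • EuclideanSpace.single i (1 : ℝ) := by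
    conv_lhs => rw [← (EuclideanSpace.basisFun (Fin d) ℝ).sum_repr z]
    simp
  have hu : MemLp u 2 (volume.restrict Ω) := Lp.memLp u
  have hgi : ∀ i, MemLp (fun x => g x i) 2 (volume.restrict Ω) := fun i =>
    (EuclideanSpace.proj (𝕜 := ℝ) i).comp_memLp' (Lp.memLp g)
  have hL : ∀ x, u x * fderiv ℝ φ x z
      = ∑ i, z i * (u x * fderiv ℝ φ x (EuclideanSpace.single i 1)) := fun x => by
    conv_lhs => rw [hz]
    simp only [map_sum, map_smul, smul_eq_mul, Finset.mul_sum]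
    exact Finset.sum_congr rfl fun i _ => by ring
  have hR : ∀ x, ⟪g x, φ x • z⟫_ℝ = ∑ i, z i * (g x i * φ x) := fun x => by
    simp only [PiLp.inner_apply, PiLp.smul_apply, smul_eq_mul, RCLike.inner_apply, conj_trivial]
    exact Finset.sum_congr rfl fun i _ => by ring
  simp_rw [hL, hR]
  rw [integral_finsetSum, integral_finsetSum, ← Finset.sum_neg_distrib]
  · refine Finset.sum_congr rfl fun i _ => ?_
    rw [integral_const_mul, integral_const_mul, h φ h1 h2 h3 i, mul_neg]
  · intro i _
    exact ((hgi i).integrable_mul (memLp_of_contDiff h1 h2 2 _)).const_mul _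
  · intro i _
    refine (hu.integrable_mul (q := 2) ?_).const_mul _
    exact ((h1.continuous_fderiv (by simp)).clm_apply
      continuous_const).memLp_of_hasCompactSupport (h2.fderiv_apply ℝ _)

theorem abs_integral_inner_smul_le (g : L2Vec Ω) {φ : EuclideanSpace ℝ (Fin d) → ℝ}
    (hφ : MemLp φ 2 (volume.restrict Ω)) (z : EuclideanSpace ℝ (Fin d)) :
    |∫ x in Ω, ⟪g x, φ x • z⟫_ℝ| ≤ ‖g‖ * (‖z‖ * ‖hφ.toLp φ‖) := by
  have hm : MemLp (fun x => φ x • z) 2 (volume.restrict Ω) :=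
    ((ContinuousLinearMap.id ℝ ℝ).smulRight z).comp_memLp' hφ
  have h1 : ∫ x in Ω, ⟪g x, φ x • z⟫_ℝ = ⟪g, hm.toLp _⟫_ℝ := by
    rw [L2.inner_def]
    refine integral_congr_ae ?_
    filter_upwards [hm.coeFn_toLp] with x hx
    rw [hx]
  rw [h1]
  refine (abs_real_inner_le_norm _ _).trans (mul_le_mul_of_nonneg_left ?_ (norm_nonneg _))
  refine Lp.norm_le_mul_norm_of_ae_le_mul ?_
  filter_upwards [hm.coeFn_toLp, hφ.coeFn_toLp] with x hx hx'
  rw [hx, hx', norm_smul, mul_comm]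

theorem norm_toLp_translate_le {φ : EuclideanSpace ℝ (Fin d) → ℝ} (z : EuclideanSpace ℝ (Fin d))
    (h1 : MemLp φ 2 volume) (hs : tsupport φ ⊆ V)
    (h2 : MemLp (fun x => φ (x - z)) 2 (volume.restrict Ω)) (h3 : MemLp φ 2 (volume.restrict V)) :
    ‖h2.toLp _‖ ≤ ‖h3.toLp _‖ := by
  rw [Lp.norm_toLp, Lp.norm_toLp]
  refine ENNReal.toReal_mono h3.eLpNorm_ne_top ?_
  calc eLpNorm (fun x => φ (x - z)) 2 (volume.restrict Ω)
      ≤ eLpNorm (fun x => φ (x - z)) 2 volume := eLpNorm_mono_measure _ Measure.restrict_le_self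
    _ = eLpNorm φ 2 volume :=
      eLpNorm_comp_measurePreserving h1.aestronglyMeasurable (measurePreserving_sub_right volume z)
    _ = eLpNorm φ 2 (volume.restrict V) :=
      (eLpNorm_restrict_eq_of_support_subset ((subset_tsupport φ).trans hs)).symm

/-- Mean value inequality for `t ↦ ∫_Ω u φ(· - t z)`: the derivative falls on `φ`, and the weak
gradient turns it into `∫ ⟪g, φ(· - t z) z⟫`. The hypothesis `hz` keeps each translated `φ`
supported in Ω, hence admissible. -/
theorem integral_mul_translate_sub_le [IsFiniteMeasure (volume.restrict Ω)]
    {u : L2 Ω} {g : L2Vec Ω} (h : IsWeakGradient Ω u g) {z : EuclideanSpace ℝ (Fin d)}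
    (hz : ∀ x ∈ V, ∀ t ∈ Set.Icc (0 : ℝ) 1, x + t • z ∈ Ω)
    {φ : EuclideanSpace ℝ (Fin d) → ℝ} (h1 : ContDiff ℝ ∞ φ) (h2 : HasCompactSupport φ)
    (h3 : tsupport φ ⊆ V) (hm : MemLp φ 2 (volume.restrict V)) :
    |(∫ x in Ω, u x * φ (x - z)) - ∫ x in Ω, u x * φ x| ≤ ‖z‖ * ‖g‖ * ‖hm.toLp φ‖ := by
  let ψ : ℝ → EuclideanSpace ℝ (Fin d) → ℝ := fun t x => φ (x - t • z)
  have hψ1 : ∀ t, ContDiff ℝ ∞ (ψ t) := fun t => h1.comp (contDiff_id.sub contDiff_const)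
  have hψ2 : ∀ t, HasCompactSupport (ψ t) := fun t => by
    simpa [ψ, sub_eq_add_neg, Function.comp_def] using h2.comp_homeomorph (Homeomorph.addRight (-(t • z)))
  have hψ3 : ∀ t ∈ Set.Icc (0 : ℝ) 1, tsupport (ψ t) ⊆ Ω := fun t ht x hx => by
    have h4 : x - t • z ∈ tsupport φ :=
      tsupport_comp_subset_preimage φ (f := fun x => x - t • z) (by fun_prop) hx
    simpa using hz _ (h3 h4) t ht
  have hψm : ∀ t, MemLp (ψ t) 2 (volume.restrict Ω) := fun t =>
    memLp_of_contDiff (hψ1 t) (hψ2 t) 2 _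
  have hu : MemLp u 2 (volume.restrict Ω) := Lp.memLp u
  have hderiv : ∀ t x, HasDerivAt (fun t => ψ t x) (- fderiv ℝ (ψ t) x z) t := fun t x => by
    have h5 : fderiv ℝ (ψ t) x = fderiv ℝ φ (x - t • z) := by
      simp only [ψ]
      exact fderiv_comp_sub (f := φ) (t • z)
    have h6 : HasDerivAt (fun t : ℝ => x - t • z) (-z) t := by
      simpa using ((hasDerivAt_id t).smul_const z).const_sub x
    rw [h5, ← map_neg]
    exact ((h1.differentiable (by simp)) _).hasFDerivAt.comp_hasDerivAt t h6
  obtain ⟨C, hC⟩ := (h1.continuous_fderiv (by simp)).bounded_above_of_compact_support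
    (h2.fderiv ℝ)
  have hd : ∀ t, HasDerivAt (fun t => ∫ x in Ω, u x * ψ t x)
      (∫ x in Ω, u x * (- fderiv ℝ (ψ t) x z)) t := fun t => by
    refine (hasDerivAt_integral_of_dominated_loc_of_deriv_le (s := Set.univ)
      (F := fun t x => u x * ψ t x) (F' := fun t x => u x * (- fderiv ℝ (ψ t) x z))
      (bound := fun x => ‖u x‖ * (C * ‖z‖)) univ_mem ?_ ?_ ?_ ?_ ?_ ?_).2
    · exact .of_forall fun t => hu.aestronglyMeasurable.mul (hψm t).aestronglyMeasurable
    · exact hu.integrable_mul (hψm t)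
    · refine hu.aestronglyMeasurable.mul (Continuous.aestronglyMeasurable ?_).neg
      exact ((hψ1 t).continuous_fderiv (by simp)).clm_apply continuous_const
    · refine .of_forall fun x t _ => ?_
      rw [norm_mul, norm_neg]
      refine mul_le_mul_of_nonneg_left ((ContinuousLinearMap.le_opNorm _ _).trans
        (mul_le_mul_of_nonneg_right ?_ (norm_nonneg _))) (norm_nonneg _)
      simp only [ψ]
      rw [fderiv_comp_sub (f := φ) (t • z)]
      exact hC _
    · exact (hu.integrable (by norm_num)).norm.mul_const _
    · exact .of_forall fun x t _ => (hderiv t x).const_mul _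
  have hbound : ∀ t ∈ Set.Icc (0 : ℝ) 1,
      ‖∫ x in Ω, u x * (- fderiv ℝ (ψ t) x z)‖ ≤ ‖z‖ * ‖g‖ * ‖hm.toLp φ‖ := fun t ht => by
    simp_rw [mul_neg]
    rw [integral_neg, h.integral_mul_fderiv (hψ1 t) (hψ2 t) (hψ3 t ht), neg_neg, Real.norm_eq_abs,
      mul_comm ‖z‖, mul_assoc]
    refine (abs_integral_inner_smul_le g (hψm t) z).trans ?_
    gcongr
    exact norm_toLp_translate_le (t • z) (memLp_of_contDiff h1 h2 2 _) h3 (hψm t) hm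
  have := norm_image_sub_le_of_norm_deriv_le_segment_01'
    (fun t _ => (hd t).hasDerivWithinAt) fun t ht => hbound t (Set.Ico_subset_Icc_self ht)
  simpa [ψ] using this

/-- The translation estimate `∫_V |u(x+z) - u(x)|² ≤ |z|² ∫_Ω |∇u|²`. -/
theorem lintegral_translate_sub_sq_le [IsFiniteMeasure (volume.restrict Ω)] (hΩ : IsOpen Ω)
    (hV : IsOpen V) {u : L2 Ω} {g : L2Vec Ω} (h : IsWeakGradient Ω u g)
    {z : EuclideanSpace ℝ (Fin d)} (hz : ∀ x ∈ V, ∀ t ∈ Set.Icc (0 : ℝ) 1, x + t • z ∈ Ω) :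
    ∫⁻ x in V, ‖u (x + z) - u x‖ₑ ^ 2 ≤ ENNReal.ofReal ((‖z‖ * ‖g‖) ^ 2) := by
  have hVΩ : V ⊆ Ω := fun x hx => by simpa using hz x hx 0 (by simp)
  have hVz : V ⊆ (fun x => x + z) ⁻¹' Ω := fun x hx => by simpa using hz x hx 1 (by simp)
  have hfin : IsFiniteMeasure (volume.restrict V) :=
    isFiniteMeasure_of_le _ (Measure.restrict_mono hVΩ le_rfl)
  have hu : MemLp u 2 (volume.restrict Ω) := Lp.memLp u
  have hm1 : MemLp u 2 (volume.restrict V) := hu.mono_measure (Measure.restrict_mono hVΩ le_rfl)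
  have hm2 : MemLp (fun x => u (x + z)) 2 (volume.restrict V) :=
    (hu.comp_measurePreserving ((measurePreserving_add_right volume z).restrict_preimage
      hΩ.measurableSet)).mono_measure (Measure.restrict_mono hVz le_rfl)
  have hm : MemLp (fun x => u (x + z) - u x) 2 (volume.restrict V) := hm2.sub hm1
  -- By duality: pair with a test function and move the translation onto it.
  have key : ‖hm.toLp _‖ ≤ ‖z‖ * ‖g‖ := by
    refine norm_le_of_forall_test hV (by positivity) ?_
    rintro v ⟨φ, h1, h2, h3, h4⟩
    have hφ := memLp_of_contDiff h1 h2 2 (volume.restrict V)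
    have hv : v = hφ.toLp φ := Lp.ext_iff.2 (h4.trans hφ.coeFn_toLp.symm)
    have e0 : ∀ {x}, x ∉ V → φ x = 0 := fun hx =>
      image_eq_zero_of_notMem_tsupport fun h => hx (h3 h)
    have e1 : ∫ x in V, u x * φ x = ∫ x in Ω, u x * φ x := by
      refine (setIntegral_eq_of_subset_of_forall_sdiff_eq_zero hΩ.measurableSet hVΩ ?_).symm
      exact fun x hx => by rw [e0 hx.2, mul_zero]
    have e2 : ∫ x in V, u (x + z) * φ x = ∫ x in Ω, u x * φ (x - z) := by
      rw [setIntegral_eq_integral_of_forall_compl_eq_zero fun x hx => by rw [e0 hx, mul_zero],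
        setIntegral_eq_integral_of_forall_compl_eq_zero fun x hx => by
          rw [e0 fun h => hx (by simpa using hVz h), mul_zero],
        ← integral_add_right_eq_self (fun x => u x * φ (x - z)) z]
      simp
    have e3 : ⟪hm.toLp _, v⟫_ℝ
        = (∫ x in Ω, u x * φ (x - z)) - ∫ x in Ω, u x * φ x := by
      rw [← e1, ← e2, ← integral_sub (f := fun x => u (x + z) * φ x) (g := fun x => u x * φ x)
        (hm2.integrable_mul hφ) (hm1.integrable_mul hφ), inner_eq_integral_mul]
      refine integral_congr_ae ?_
      filter_upwards [hm.coeFn_toLp, h4] with x hx hx'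
      rw [hx, hx']
      ring
    rw [e3, hv]
    exact (le_abs_self _).trans (integral_mul_translate_sub_le h hz h1 h2 h3 hφ)
  calc ∫⁻ x in V, ‖u (x + z) - u x‖ₑ ^ 2
      = ∫⁻ x in V, ‖hm.toLp _ x‖ₑ ^ 2 := by
        refine lintegral_congr_ae ?_
        filter_upwards [hm.coeFn_toLp] with x hx
        rw [hx]
    _ = ENNReal.ofReal (‖hm.toLp _‖ ^ 2) := lintegral_enorm_sq_coeFn _
    _ ≤ _ := ENNReal.ofReal_le_ofReal (pow_le_pow_left₀ (norm_nonneg _) key 2)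

end

section

variable {d : ℕ} {Ω V W : Set (EuclideanSpace ℝ (Fin d))}

/-! ### Averages -/

/-- Substitute `y = x + z`. All differences `z` lie in `Z` and the `E k` are disjoint in `V`, so the
sum is at most a double integral over `V × Z`. Tonelli and the translation estimate for each fixed
`z` finish. -/
theorem sum_lintegral_lintegral_sub_sq_le [IsFiniteMeasure (volume.restrict Ω)] (hΩ : IsOpen Ω)
    (hV : IsOpen V) {u : L2 Ω} {g : L2Vec Ω} (h : IsWeakGradient Ω u g)
    {Z : Set (EuclideanSpace ℝ (Fin d))} (hZm : MeasurableSet Z)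
    (hZ : ∀ x ∈ V, ∀ z ∈ Z, ∀ t ∈ Set.Icc (0 : ℝ) 1, x + t • z ∈ Ω) {R : ℝ}
    (hR : ∀ z ∈ Z, ‖z‖ ≤ R) {n : ℕ} {E B : ℕ → Set (EuclideanSpace ℝ (Fin d))}
    (hEm : ∀ k, MeasurableSet (E k)) (hEV : ∀ k, E k ⊆ V) (hEd : Pairwise (Function.onFun Disjoint E))
    (hBm : ∀ k, MeasurableSet (B k)) (hEB : ∀ k, ∀ x ∈ E k, ∀ y ∈ B k, y - x ∈ Z) :
    ∑ k ∈ Finset.range n, ∫⁻ x in E k, ∫⁻ y in B k, ‖u y - u x‖ₑ ^ 2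
      ≤ volume Z * ENNReal.ofReal ((R * ‖g‖) ^ 2) := by
  have hu : Measurable u := (Lp.stronglyMeasurable u).measurable
  have hin : ∀ k, ∀ x ∈ E k, ∫⁻ y in B k, ‖u y - u x‖ₑ ^ 2
      ≤ ∫⁻ z in Z, ‖u (x + z) - u x‖ₑ ^ 2 := fun k x hx => by
    rw [← lintegral_indicator (hBm k), ← lintegral_indicator hZm,
      ← lintegral_add_left_eq_self _ x]
    refine lintegral_mono fun z => ?_
    by_cases hz : x + z ∈ B k
    · have : z ∈ Z := by simpa using hEB k x hx _ hz
      rw [Set.indicator_of_mem hz, Set.indicator_of_mem this]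
    · rw [Set.indicator_of_notMem hz]
      exact zero_le
  calc ∑ k ∈ Finset.range n, ∫⁻ x in E k, ∫⁻ y in B k, ‖u y - u x‖ₑ ^ 2
      ≤ ∑ k ∈ Finset.range n, ∫⁻ x in E k, ∫⁻ z in Z, ‖u (x + z) - u x‖ₑ ^ 2 :=
        Finset.sum_le_sum fun k _ => setLIntegral_mono' (hEm k) (hin k)
    _ = ∫⁻ x in ⋃ k ∈ Finset.range n, E k, ∫⁻ z in Z, ‖u (x + z) - u x‖ₑ ^ 2 :=
        (lintegral_biUnion_finset (hEd.set_pairwise _) (fun k _ => hEm k) _).symm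
    _ ≤ ∫⁻ x in V, ∫⁻ z in Z, ‖u (x + z) - u x‖ₑ ^ 2 :=
        lintegral_mono_set (Set.iUnion₂_subset fun k _ => hEV k)
    _ = ∫⁻ z in Z, ∫⁻ x in V, ‖u (x + z) - u x‖ₑ ^ 2 := by
        refine lintegral_lintegral_swap (Measurable.aemeasurable ?_)
        simp only [Function.uncurry_def]
        fun_prop
    _ ≤ ∫⁻ z in Z, ENNReal.ofReal ((R * ‖g‖) ^ 2) := by
        refine setLIntegral_mono' hZm fun z hz => ?_
        refine (lintegral_translate_sub_sq_le hΩ hV h fun x hx t ht => hZ x hx z hz t ht).trans ?_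
        gcongr
        exact hR z hz
    _ = volume Z * ENNReal.ofReal ((R * ‖g‖) ^ 2) := by
        rw [setLIntegral_const, mul_comm]

theorem sq_lintegral_le {α : Type*} {_ : MeasurableSpace α} (μ : Measure α) {f : α → ℝ≥0∞}
    (hf : AEMeasurable f μ) : (∫⁻ x, f x ∂μ) ^ 2 ≤ μ Set.univ * ∫⁻ x, f x ^ 2 ∂μ := by
  have h := ENNReal.lintegral_mul_le_Lp_mul_Lq μ Real.HolderConjugate.two_two hf
    (aemeasurable_const (b := (1 : ℝ≥0∞)))
  have h2 : ∀ a : ℝ≥0∞, (a ^ (1 / 2 : ℝ)) ^ 2 = a := fun a => by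
    rw [← ENNReal.rpow_natCast, ← ENNReal.rpow_mul]
    norm_num
  have h3 := pow_le_pow_left₀ zero_le h 2
  rw [mul_pow, h2, h2] at h3
  simpa [mul_comm] using h3

/-- The difference is, up to sign, the mean of `f - c`; then Cauchy–Schwarz. -/
theorem enorm_sub_average_sq_le {α : Type*} {_ : MeasurableSpace α} {μ : Measure α} {f : α → ℝ}
    {S : Set α} (hf : IntegrableOn f S μ) (h0 : μ S ≠ 0) (h1 : μ S ≠ ⊤) (c : ℝ) :
    ‖c - (μ S).toReal⁻¹ * ∫ y in S, f y ∂μ‖ₑ ^ 2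
      ≤ (μ S)⁻¹ * ∫⁻ y in S, ‖f y - c‖ₑ ^ 2 ∂μ := by
  have hpos : 0 < (μ S).toReal := ENNReal.toReal_pos h0 h1
  have hci : IntegrableOn (fun _ => c) S μ := integrableOn_const h1
  have e1 : c - (μ S).toReal⁻¹ * ∫ y in S, f y ∂μ
      = -((μ S).toReal⁻¹ * ∫ y in S, (f y - c) ∂μ) := by
    rw [integral_sub hf hci, setIntegral_const, Measure.real, smul_eq_mul]
    field_simp
    ring
  have e2 : ‖(μ S).toReal⁻¹‖ₑ = (μ S)⁻¹ := by
    rw [Real.enorm_of_nonneg (by positivity), ENNReal.ofReal_inv_of_pos hpos,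
      ENNReal.ofReal_toReal h1]
  rw [e1, enorm_neg, enorm_mul, e2, mul_pow]
  calc (μ S)⁻¹ ^ 2 * ‖∫ y in S, (f y - c) ∂μ‖ₑ ^ 2
      ≤ (μ S)⁻¹ ^ 2 * (μ S * ∫⁻ y in S, ‖f y - c‖ₑ ^ 2 ∂μ) := by
        gcongr
        refine (pow_le_pow_left₀ zero_le (enorm_integral_le_lintegral_enorm _) 2).trans ?_
        simpa using sq_lintegral_le (μ.restrict S) (hf.sub hci).aestronglyMeasurable.enorm
    _ = (μ S)⁻¹ * ∫⁻ y in S, ‖f y - c‖ₑ ^ 2 ∂μ := by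
        rw [← mul_assoc, sq, mul_assoc (μ S)⁻¹, ENNReal.inv_mul_cancel h0 h1,
          mul_one]

/-- On `W`, the inclusion `H¹(Ω) → L²(Ω)` is a limit of compact operators on `L²(Ω)`. -/
def HasCompactApprox (Ω W : Set (EuclideanSpace ℝ (Fin d))) : Prop :=
  ∀ ε > 0, ∃ F : L2 Ω →L[ℝ] L2 Ω, IsCompactOperator F ∧
    (∀ u, ∀ᵐ x ∂(volume.restrict Ω), x ∉ W → F u x = 0) ∧
    ∀ u g, IsWeakGradient Ω u g → ∫⁻ x in W, ‖u x - F u x‖ₑ ^ 2 ≤ ENNReal.ofReal ((ε * ‖g‖) ^ 2)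

theorem isCompactOperator_innerSL_smulRight {H : Type*} [NormedAddCommGroup H]
    [InnerProductSpace ℝ H] (a b : H) : IsCompactOperator ((innerSL ℝ a).smulRight b) := by
  have h := (isCompactOperator_of_locallyCompactSpace_dom (innerSL ℝ a)).clm_comp
    (ContinuousLinearMap.toSpanSingleton ℝ b)
  exact h

/-- `F u` is, on each `E k` with `k < n`, the mean of `u` over `B k`. It has finite rank, and its
error is controlled by the double integrals over `E k × B k`. -/
theorem exists_averaging_operator [IsFiniteMeasure (volume.restrict Ω)] (hΩ : IsOpen Ω)
    (hV : IsOpen V) (hVΩ : V ⊆ Ω) {Z : Set (EuclideanSpace ℝ (Fin d))} (hZm : MeasurableSet Z)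
    (hZ : ∀ x ∈ V, ∀ z ∈ Z, ∀ t ∈ Set.Icc (0 : ℝ) 1, x + t • z ∈ Ω) {R : ℝ}
    (hR : ∀ z ∈ Z, ‖z‖ ≤ R) {n : ℕ} {E B : ℕ → Set (EuclideanSpace ℝ (Fin d))}
    (hEm : ∀ k, MeasurableSet (E k)) (hEV : ∀ k, E k ⊆ V) (hEd : Pairwise (Function.onFun Disjoint E))
    (hBm : ∀ k, MeasurableSet (B k)) (hEB : ∀ k, ∀ x ∈ E k, ∀ y ∈ B k, y - x ∈ Z)
    {b : ℝ≥0∞} (hb : ∀ k, volume (B k) = b) (hb0 : b ≠ 0) (hb1 : b ≠ ⊤)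
    (hW : W = ⋃ k ∈ Finset.range n, E k) :
    ∃ F : L2 Ω →L[ℝ] L2 Ω, IsCompactOperator F ∧
      (∀ u, ∀ᵐ x ∂(volume.restrict Ω), x ∉ W → F u x = 0) ∧
      ∀ u g, IsWeakGradient Ω u g → ∫⁻ x in W, ‖u x - F u x‖ₑ ^ 2
        ≤ b⁻¹ * (volume Z * ENNReal.ofReal ((R * ‖g‖) ^ 2)) := by
  let κ : ℕ → L2 Ω := fun k => indicatorConstLp 2 (hBm k) (measure_ne_top _ _) 1
  let e : ℕ → L2 Ω := fun k => indicatorConstLp 2 (hEm k) (measure_ne_top _ _) 1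
  let F : L2 Ω →L[ℝ] L2 Ω :=
    ∑ k ∈ Finset.range n, (innerSL ℝ (κ k)).smulRight (b.toReal⁻¹ • e k)
  have hF : ∀ u, ∀ᵐ x ∂(volume.restrict Ω), F u x = ∑ k ∈ Finset.range n,
      (E k).indicator (fun _ => b.toReal⁻¹ * ⟪κ k, u⟫_ℝ) x := fun u => by
    have h1 : F u = ∑ k ∈ Finset.range n, (⟪κ k, u⟫_ℝ * b.toReal⁻¹) • e k := by
      simp [F, smul_smul]
    have h2 : ∀ᵐ x ∂(volume.restrict Ω), ∀ k, ((⟪κ k, u⟫_ℝ * b.toReal⁻¹) • e k : L2 Ω) x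
        = (E k).indicator (fun _ => b.toReal⁻¹ * ⟪κ k, u⟫_ℝ) x := by
      refine ae_all_iff.2 fun k => ?_
      filter_upwards [Lp.coeFn_smul (⟪κ k, u⟫_ℝ * b.toReal⁻¹) (e k),
        indicatorConstLp_coeFn (p := 2) (hs := hEm k)
          (hμs := measure_ne_top (volume.restrict Ω) _) (c := (1 : ℝ))] with x hx hx'
      rw [hx, Pi.smul_apply, hx', smul_eq_mul, mul_comm b.toReal⁻¹]
      by_cases hxE : x ∈ E k <;> simp [hxE]
    rw [h1]
    filter_upwards [Lp.coeFn_finsetSum (Finset.range n)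
      fun k => (⟪κ k, u⟫_ℝ * b.toReal⁻¹) • e k, h2] with x hx hx2
    rw [hx, Finset.sum_apply]
    exact Finset.sum_congr rfl fun k _ => hx2 k
  refine ⟨F, ?_, fun u => ?_, fun u g h => ?_⟩
  · exact Submodule.sum_mem (compactOperator (RingHom.id ℝ) (L2 Ω) (L2 Ω)) fun k _ =>
      isCompactOperator_innerSL_smulRight _ _
  · filter_upwards [hF u] with x hx hxW
    rw [hx]
    refine Finset.sum_eq_zero fun k hk => Set.indicator_of_notMem (fun hxE => hxW ?_) _
    rw [hW]
    exact Set.mem_biUnion hk hxE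
  -- `B k ⊆ Ω` is available only when `E k` has a point; otherwise `B k` plays no role in the
  -- estimate.
  · have hFE : ∀ k ∈ Finset.range n, ∀ᵐ x ∂volume, x ∈ E k →
        F u x = b.toReal⁻¹ * ∫ y in B k, u y := fun k hk => by
      filter_upwards [(ae_restrict_iff' hΩ.measurableSet).1 (hF u)] with x hx hxE
      have hBΩ : B k ⊆ Ω := fun y hy => by
        simpa using hZ x (hEV k hxE) _ (hEB k x hxE y hy) 1 (by simp)
      rw [hx (hVΩ (hEV k hxE)), Finset.sum_eq_single_of_mem k hk, Set.indicator_of_mem hxE,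
        L2.inner_indicatorConstLp_one, Measure.restrict_restrict (hBm k),
        Set.inter_eq_left.2 hBΩ]
      intro j _ hj
      exact Set.indicator_of_notMem (fun hxj => Set.disjoint_left.1 (hEd hj) hxj hxE) _
    rw [hW, lintegral_biUnion_finset (hEd.set_pairwise _) (fun k _ => hEm k)]
    calc ∑ k ∈ Finset.range n, ∫⁻ x in E k, ‖u x - F u x‖ₑ ^ 2
        ≤ ∑ k ∈ Finset.range n, ∫⁻ x in E k, b⁻¹ * ∫⁻ y in B k, ‖u y - u x‖ₑ ^ 2 := by
          refine Finset.sum_le_sum fun k hk => ?_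
          refine lintegral_mono_ae ((ae_restrict_iff' (hEm k)).2 ?_)
          filter_upwards [hFE k hk] with x hx hxE
          have hBΩ : B k ⊆ Ω := fun y hy => by
            simpa using hZ x (hEV k hxE) _ (hEB k x hxE y hy) 1 (by simp)
          have hΩi : IntegrableOn u Ω volume := (Lp.memLp u).integrable (by norm_num)
          have hint : IntegrableOn u (B k) volume := hΩi.mono_set hBΩ
          rw [hx hxE, ← hb k]
          exact enorm_sub_average_sq_le hint (by rwa [hb]) (by rwa [hb]) (u x)
      _ = b⁻¹ * ∑ k ∈ Finset.range n, ∫⁻ x in E k, ∫⁻ y in B k, ‖u y - u x‖ₑ ^ 2 := by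
          rw [Finset.mul_sum]
          exact Finset.sum_congr rfl fun k _ => lintegral_const_mul' _ _ (ENNReal.inv_ne_top.2 hb0)
      _ ≤ _ := by
          gcongr
          exact sum_lintegral_lintegral_sub_sq_le hΩ hV h hZm hZ hR hEm hEV hEd hBm hEB

end

section

variable {d : ℕ} {Ω V W : Set (EuclideanSpace ℝ (Fin d))}

/-! ### Compactness of the inclusion `H¹(Ω) → L²(Ω)` -/

/-- A fixed open truncated cone with vertex at any point of `V` is contained in `Ω`. -/
def UniformCone (Ω V : Set (EuclideanSpace ℝ (Fin d))) : Prop :=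
  ∃ (ν : EuclideanSpace ℝ (Fin d)) (c τ₀ : ℝ), 0 < c ∧ 0 < τ₀ ∧
    ∀ x ∈ V, ∀ τ, 0 < τ → τ ≤ τ₀ → ∀ y, ‖y‖ ≤ c * τ → x + (τ • ν + y) ∈ Ω

/-- Cut `W` into cells near points `p k` of a finite `δ`-net and average over the balls of radius
`δ` about `p k + τ ν`. Differences between such a ball and its cell lie in the ball of radius `2 δ =
c τ` about `τ ν`, which fits inside the cone. -/
theorem UniformCone.hasCompactApprox [IsFiniteMeasure (volume.restrict Ω)] (hΩ : IsOpen Ω)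
    (hV : IsOpen V) (hVΩ : V ⊆ Ω) (hc : UniformCone Ω V) (hWV : W ⊆ V) (hWm : MeasurableSet W)
    (hWb : Bornology.IsBounded W) : HasCompactApprox Ω W := by
  obtain ⟨ν, c, τ₀, hc0, hτ₀, hcone⟩ := hc
  intro ε hε
  set K : ℝ := ‖ν‖ + c with hK
  have hKpos : 0 < K := by positivity
  -- Differences have length at most `τ K`, and the volume ratio of the balls of radius `2 δ` and
  -- `δ` is `2 ^ d`; this `τ` absorbs both into `ε`.
  set τ : ℝ := min τ₀ (ε / (2 ^ d * K)) with hτ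
  have hτpos : 0 < τ := lt_min hτ₀ (by positivity)
  set δ : ℝ := c * τ / 2 with hδ
  have hδpos : 0 < δ := by positivity
  have hWt : TotallyBounded W := hWb.isCompact_closure.totallyBounded.subset subset_closure
  obtain ⟨t, ht, hcov⟩ := Metric.totallyBounded_iff.1 hWt δ hδpos
  obtain ⟨n, p, hp⟩ : ∃ (n : ℕ) (p : ℕ → EuclideanSpace ℝ (Fin d)),
      ∀ y ∈ t, ∃ k < n, p k = y := by
    obtain ⟨n, e⟩ := (Set.finite_coe_iff.2 ht).exists_equiv_fin
    obtain ⟨e⟩ := e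
    -- The net is extended by the junk value `0`; only indices below `n` are needed to cover `W`.
    refine ⟨n, fun k => if hk : k < n then e.symm ⟨k, hk⟩ else 0, fun y hy => ?_⟩
    exact ⟨e ⟨y, hy⟩, (e ⟨y, hy⟩).2, by simp⟩
  let E : ℕ → Set (EuclideanSpace ℝ (Fin d)) := fun k =>
    (W ∩ Metric.ball (p k) δ) \ ⋃ j ∈ Finset.range k, Metric.ball (p j) δ
  let B : ℕ → Set (EuclideanSpace ℝ (Fin d)) := fun k => Metric.ball (p k + τ • ν) δ
  have hEd : Pairwise (Function.onFun Disjoint E) := by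
    refine pairwise_disjoint_on E |>.2 fun i j hij => Set.disjoint_left.2 fun x hi hj => hj.2 ?_
    exact Set.mem_biUnion (Finset.mem_coe.2 (Finset.mem_range.2 hij)) hi.1.2
  have hW : W = ⋃ k ∈ Finset.range n, E k := by
    refine Set.Subset.antisymm (fun x hx => ?_) (Set.iUnion₂_subset fun k _ x hx => hx.1.1)
    obtain ⟨y, hy, hxy⟩ := Set.mem_iUnion₂.1 (hcov hx)
    obtain ⟨k, hkn, rfl⟩ := hp y hy
    classical
    have hex : ∃ k, x ∈ Metric.ball (p k) δ := ⟨k, hxy⟩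
    refine Set.mem_biUnion (x := Nat.find hex)
      (Finset.mem_coe.2 (Finset.mem_range.2 ((Nat.find_min' hex hxy).trans_lt hkn)))
      ⟨⟨hx, Nat.find_spec hex⟩, fun hmem => ?_⟩
    obtain ⟨j, hj, hxj⟩ := Set.mem_iUnion₂.1 hmem
    exact Nat.find_min hex (Finset.mem_range.1 hj) hxj
  have hZ : ∀ x ∈ V, ∀ z ∈ Metric.ball (τ • ν) (2 * δ), ∀ s ∈ Set.Icc (0 : ℝ) 1,
      x + s • z ∈ Ω := fun x hx z hz s hs => by
    -- The cone excludes its vertex, so `s = 0` is separate.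
    rcases hs.1.eq_or_lt with h0 | h0
    · simpa [← h0] using hVΩ hx
    · have h1 := hcone x hx (s * τ) (by positivity)
        ((mul_le_of_le_one_left hτpos.le hs.2).trans (min_le_left _ _)) (s • (z - τ • ν)) (by
          rw [norm_smul, Real.norm_of_nonneg hs.1, mul_left_comm]
          refine mul_le_mul_of_nonneg_left ?_ hs.1
          rw [← dist_eq_norm]
          linarith [Metric.mem_ball.1 hz])
      rwa [mul_smul, ← smul_add, add_sub_cancel] at h1
  have hR : ∀ z ∈ Metric.ball (τ • ν) (2 * δ), ‖z‖ ≤ τ * K := fun z hz => by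
    have h1 : ‖z - τ • ν‖ ≤ 2 * δ := by rw [← dist_eq_norm]; exact (Metric.mem_ball.1 hz).le
    have h2 := norm_le_norm_add_norm_sub' z (τ • ν)
    rw [norm_smul, Real.norm_of_nonneg hτpos.le] at h2
    nlinarith
  have hEB : ∀ k, ∀ x ∈ E k, ∀ y ∈ B k, y - x ∈ Metric.ball (τ • ν) (2 * δ) :=
    fun k x hx y hy => by
      have h1 := Metric.mem_ball.1 hx.1.2
      have h2 := Metric.mem_ball.1 hy
      rw [dist_eq_norm] at h1 h2
      rw [Metric.mem_ball, dist_eq_norm,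
        show y - x - τ • ν = (y - (p k + τ • ν)) - (x - p k) by abel]
      linarith [norm_sub_le (y - (p k + τ • ν)) (x - p k)]
  obtain ⟨F, hF1, hF2, hF3⟩ := exists_averaging_operator hΩ hV hVΩ measurableSet_ball hZ hR
    (n := n) (E := E) (B := B) (b := volume (Metric.ball (0 : EuclideanSpace ℝ (Fin d)) δ))
    (fun k => (hWm.inter measurableSet_ball).diff
      (Finset.measurableSet_biUnion _ fun _ _ => measurableSet_ball))
    (fun k x hx => hWV hx.1.1) hEd (fun k => measurableSet_ball) hEB
    (fun k => Measure.addHaar_ball_center _ _ _)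
    (Metric.measure_ball_pos _ _ hδpos).ne' measure_ball_lt_top.ne hW
  refine ⟨F, hF1, hF2, fun u g h => (hF3 u g h).trans ?_⟩
  rw [Measure.addHaar_ball_mul_of_pos _ _ two_pos, finrank_euclideanSpace_fin, mul_comm
    (ENNReal.ofReal _) (volume _), mul_assoc, ← mul_assoc, ENNReal.inv_mul_cancel
    (Metric.measure_ball_pos _ _ hδpos).ne' measure_ball_lt_top.ne, one_mul,
    ← ENNReal.ofReal_mul (by positivity)]
  refine ENNReal.ofReal_le_ofReal ?_
  -- The factor `2 ^ d` stands outside the square; being at least one, it is bounded by its own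
  -- square.
  have h1 : (1 : ℝ) ≤ 2 ^ d := one_le_pow₀ one_le_two
  have h2 : 2 ^ d * (τ * K) ≤ ε := by
    have := min_le_right τ₀ (ε / (2 ^ d * K))
    rw [le_div_iff₀ (by positivity)] at this
    linarith
  calc 2 ^ d * (τ * K * ‖g‖) ^ 2 ≤ 2 ^ d * (2 ^ d * (τ * K * ‖g‖) ^ 2) :=
        le_mul_of_one_le_left (by positivity) h1
    _ = (2 ^ d * (τ * K) * ‖g‖) ^ 2 := by ring
    _ ≤ (ε * ‖g‖) ^ 2 := by gcongr

/-- Add the two operators: each vanishes off its own piece, so on either piece the sum acts as one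
of them. This is why the definition demands vanishing off `W`. -/
theorem HasCompactApprox.union {W' : Set (EuclideanSpace ℝ (Fin d))} (hW : MeasurableSet W)
    (hW' : MeasurableSet W') (hWΩ : W ⊆ Ω) (hWΩ' : W' ⊆ Ω) (hd : Disjoint W W')
    (h : HasCompactApprox Ω W) (h' : HasCompactApprox Ω W') : HasCompactApprox Ω (W ∪ W') := by
  intro ε hε
  obtain ⟨F, h1, h2, h3⟩ := h (ε / 2) (half_pos hε)
  obtain ⟨F', h1', h2', h3'⟩ := h' (ε / 2) (half_pos hε)
  have hadd : ∀ u, ∀ᵐ x ∂(volume.restrict Ω), (F + F') u x = F u x + F' u x := fun u =>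
    Lp.coeFn_add (F u) (F' u)
  refine ⟨F + F', h1.add h1', fun u => ?_, fun u g hug => ?_⟩
  · filter_upwards [h2 u, h2' u, hadd u] with x hx hx' hx2 hxW
    rw [hx2, hx fun h => hxW (Or.inl h), hx' fun h => hxW (Or.inr h), add_zero]
  · have e1 : ∫⁻ x in W, ‖u x - (F + F') u x‖ₑ ^ 2 = ∫⁻ x in W, ‖u x - F u x‖ₑ ^ 2 := by
      refine setLIntegral_congr_fun_ae hW ?_
      filter_upwards [ae_imp_of_ae_restrict (h2' u), ae_imp_of_ae_restrict (hadd u)]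
        with x hx hx' hxW
      rw [hx' (hWΩ hxW), hx (hWΩ hxW) (Set.disjoint_left.1 hd hxW), add_zero]
    have e2 : ∫⁻ x in W', ‖u x - (F + F') u x‖ₑ ^ 2 = ∫⁻ x in W', ‖u x - F' u x‖ₑ ^ 2 := by
      refine setLIntegral_congr_fun_ae hW' ?_
      filter_upwards [ae_imp_of_ae_restrict (h2 u), ae_imp_of_ae_restrict (hadd u)]
        with x hx hx' hxW
      rw [hx' (hWΩ' hxW), hx (hWΩ' hxW) (Set.disjoint_right.1 hd hxW), zero_add]
    rw [lintegral_union hW' hd, e1, e2]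
    refine (add_le_add (h3 u g hug) (h3' u g hug)).trans ?_
    rw [← ENNReal.ofReal_add (by positivity) (by positivity)]
    refine ENNReal.ofReal_le_ofReal ?_
    nlinarith [sq_nonneg (ε * ‖g‖)]

theorem hasCompactApprox_empty : HasCompactApprox Ω ∅ := fun ε hε =>
  ⟨0, isCompactOperator_zero, fun u => by
    filter_upwards [Lp.coeFn_zero ℝ 2 (volume.restrict Ω)] with x hx _ using hx, fun u g _ => by simp⟩

theorem hasCompactApprox_self [IsFiniteMeasure (volume.restrict Ω)] (hΩ : IsOpen Ω)
    (hb : Bornology.IsBounded Ω)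
    (h : ∀ p ∈ closure Ω, ∃ r > 0, UniformCone Ω (Ω ∩ Metric.ball p r)) :
    HasCompactApprox Ω Ω := by
  -- The claim quantifies over all measurable `W` inside a measurable `S'`, so that overlapping
  -- regions can be made disjoint before uniting them.
  have key : ∃ S', MeasurableSet S' ∧ closure Ω ⊆ S' ∧
      ∀ W ⊆ Ω ∩ S', MeasurableSet W → HasCompactApprox Ω W := by
    refine hb.isCompact_closure.induction_on (p := fun S => ∃ S', MeasurableSet S' ∧ S ⊆ S' ∧
      ∀ W ⊆ Ω ∩ S', MeasurableSet W → HasCompactApprox Ω W) ?_ ?_ ?_ ?_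
    · refine ⟨∅, .empty, le_rfl, fun W hW _ => ?_⟩
      rw [Set.inter_empty, Set.subset_empty_iff] at hW
      exact hW ▸ hasCompactApprox_empty
    · rintro S T hST ⟨S', h1, h2, h3⟩
      exact ⟨S', h1, hST.trans h2, h3⟩
    · rintro S T ⟨S', h1, h2, h3⟩ ⟨T', k1, k2, k3⟩
      refine ⟨S' ∪ T', h1.union k1, Set.union_subset_union h2 k2, fun W hW hWm => ?_⟩
      rw [← Set.inter_union_sdiff W S']
      have hsub : W \ S' ⊆ Ω ∩ T' := fun x hx =>
        ⟨(hW hx.1).1, (hW hx.1).2.resolve_left hx.2⟩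
      exact (h3 _ (fun x hx => ⟨(hW hx.1).1, hx.2⟩) (hWm.inter h1)).union (hWm.inter h1)
        (hWm.diff h1) (fun x hx => (hW hx.1).1) (fun x hx => (hW hx.1).1)
        (Set.disjoint_left.2 fun x hx hx' => hx'.2 hx.2) (k3 _ hsub (hWm.diff h1))
    · intro p hp
      obtain ⟨r, hr, hc⟩ := h p hp
      refine ⟨Metric.ball p r, mem_nhdsWithin_of_mem_nhds (Metric.ball_mem_nhds p hr),
        Metric.ball p r, measurableSet_ball, le_rfl, fun W hW hWm => ?_⟩
      exact hc.hasCompactApprox hΩ (hΩ.inter Metric.isOpen_ball) Set.inter_subset_left hW hWm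
        (hb.subset fun x hx => (hW hx).1)
  obtain ⟨S', -, h2, h3⟩ := key
  exact h3 Ω (fun x hx => ⟨hx, h2 (subset_closure hx)⟩) hΩ.measurableSet

/-- Moving by `τ ν + y` raises the height by at least `τ - ‖y‖` and the graph by at most `K ‖y‖`, so
the point stays above the graph once `(K + 1) ‖y‖ < τ`. -/
theorem exists_uniformCone (hΩ : IsOpen Ω) (hl : HasLipschitzBoundary Ω)
    {p : EuclideanSpace ℝ (Fin d)} (hp : p ∈ closure Ω) :
    ∃ r > 0, UniformCone Ω (Ω ∩ Metric.ball p r) := by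
  by_cases hpΩ : p ∈ Ω
  · obtain ⟨r, hr, hsub⟩ := Metric.isOpen_iff.1 hΩ p hpΩ
    -- At an interior point a ball suffices: axis `0` and aperture `1`.
    refine ⟨r / 2, half_pos hr, 0, 1, r / 2, one_pos, half_pos hr, fun x hx τ h0 h1 y hy => hsub ?_⟩
    have h2 := Metric.mem_ball.1 hx.2
    rw [Metric.mem_ball, dist_eq_norm] at *
    have := norm_add_le (x - p) y
    rw [smul_zero, zero_add, show x + y - p = x - p + y by abel]
    linarith
  · obtain ⟨ν, γ, K, r, hν, hγ, hr, hiff⟩ := hl p ⟨hp, by rwa [hΩ.interior_eq]⟩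
    -- The aperture gives `(K + 1) ‖y‖ ≤ τ / 2`; the height `r / 4` bounds the displacement by `2 τ
    -- ≤ r / 2`, which keeps the point in the chart.
    refine ⟨r / 2, half_pos hr, ν, (K + 1 : ℝ)⁻¹ / 2, r / 4, by positivity, by positivity,
      fun x hx τ h0 h1 y hy => ?_⟩
    have hK : (K + 1 : ℝ)⁻¹ / 2 ≤ 1 := by
      have : (K + 1 : ℝ)⁻¹ ≤ 1 := inv_le_one_of_one_le₀ (by linarith [K.2])
      linarith
    have hyτ : ‖y‖ ≤ τ := hy.trans (mul_le_of_le_one_left h0.le hK)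
    have hyK : (K + 1) * ‖y‖ ≤ τ / 2 := by
      have := mul_le_mul_of_nonneg_left hy (by positivity : (0 : ℝ) ≤ K + 1)
      rwa [div_mul_eq_mul_div, mul_div_assoc', ← mul_assoc, mul_inv_cancel₀ (by positivity),
        one_mul] at this
    have hxr := Metric.mem_ball.1 hx.2
    have hxp : x ∈ Metric.ball p r := Metric.mem_ball.2 (by linarith)
    have hx' : x + (τ • ν + y) ∈ Metric.ball p r := by
      rw [Metric.mem_ball, dist_eq_norm] at *
      rw [show x + (τ • ν + y) - p = (x - p) + (τ • ν + y) by abel]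
      have e1 := norm_add_le (x - p) (τ • ν + y)
      have e2 := norm_add_le (τ • ν) y
      rw [norm_smul, hν, Real.norm_of_nonneg h0.le, mul_one] at e2
      linarith
    refine (hiff _ hx').2 ?_
    have hxγ := (hiff x hxp).1 hx.1
    have hproj : (ℝ ∙ ν)ᗮ.orthogonalProjectionOnto ν = 0 :=
      Submodule.orthogonalProjectionOnto_orthogonal_apply_eq_zero (Submodule.mem_span_singleton_self ν)
    have e1 : γ ((ℝ ∙ ν)ᗮ.orthogonalProjectionOnto (x + (τ • ν + y)))
        ≤ γ ((ℝ ∙ ν)ᗮ.orthogonalProjectionOnto x) + K * ‖y‖ := by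
      have e2 := hγ.dist_le_mul ((ℝ ∙ ν)ᗮ.orthogonalProjectionOnto (x + (τ • ν + y)))
        ((ℝ ∙ ν)ᗮ.orthogonalProjectionOnto x)
      have e3 : ‖(ℝ ∙ ν)ᗮ.orthogonalProjectionOnto y‖ ≤ ‖y‖ :=
        Submodule.norm_orthogonalProjectionOnto_apply_le _ y
      rw [map_add, map_add, map_smul, hproj, smul_zero, zero_add, Real.dist_eq,
        dist_eq_norm, add_sub_cancel_left] at e2
      rw [map_add, map_add, map_smul, hproj, smul_zero, zero_add]
      have e4 := mul_le_mul_of_nonneg_left e3 K.2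
      have e5 := le_abs_self (γ ((ℝ ∙ ν)ᗮ.orthogonalProjectionOnto x
        + (ℝ ∙ ν)ᗮ.orthogonalProjectionOnto y) - γ ((ℝ ∙ ν)ᗮ.orthogonalProjectionOnto x))
      simp only [NNReal.val_eq_coe] at e4
      linarith
    have e2 : ⟪ν, x + (τ • ν + y)⟫_ℝ = ⟪ν, x⟫_ℝ + τ + ⟪ν, y⟫_ℝ := by
      rw [inner_add_right, inner_add_right, inner_smul_right, real_inner_self_eq_norm_sq, hν]
      ring
    have e3 : -‖y‖ ≤ ⟪ν, y⟫_ℝ := by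
      have := (abs_le.1 (abs_real_inner_le_norm ν y)).1
      rwa [hν, one_mul] at this
    rw [e2]
    linarith

end

section

variable {d : ℕ} {Ω : Set (EuclideanSpace ℝ (Fin d))}

/-! ### Functions with zero weak gradient -/

/-- With zero gradient, the double integral of `|u y - u x|²` over a ball vanishes; any typical `x`
then supplies the constant `u x`. -/
theorem exists_ball_ae_eq_const [IsFiniteMeasure (volume.restrict Ω)] (hΩ : IsOpen Ω) {u : L2 Ω}
    (h : IsWeakGradient Ω u 0) {p : EuclideanSpace ℝ (Fin d)} (hp : p ∈ Ω) :
    ∃ r > 0, ∃ c : ℝ, ∀ᵐ x, x ∈ Metric.ball p r → u x = c := by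
  obtain ⟨R, hR, hsub⟩ := Metric.isOpen_iff.1 hΩ p hp
  set r := R / 3 with hr
  have hrpos : 0 < r := by positivity
  -- A single cell, its own averaging region; the other indices are empty to keep the family
  -- disjoint. The radius is `R / 3` because differences reach `2 r`.
  let E : ℕ → Set (EuclideanSpace ℝ (Fin d)) := fun k => if k = 0 then Metric.ball p r else ∅
  have hE : ∀ k, E k ⊆ Metric.ball p r := fun k => by
    by_cases hk : k = 0 <;> simp [E, hk]
  have hEm : ∀ k, MeasurableSet (E k) := fun k => by
    by_cases hk : k = 0 <;> simp [E, hk, measurableSet_ball]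
  have h0 := sum_lintegral_lintegral_sub_sq_le hΩ Metric.isOpen_ball h
    (V := Metric.ball p r) (Z := Metric.ball 0 (2 * r)) (n := 1) (E := E) (B := E) (R := 2 * r)
    measurableSet_ball (fun x hx z hz t ht => hsub ?_) (fun z hz => ?_) hEm hE ?_ hEm ?_
  · simp only [Finset.range_one, Finset.sum_singleton, norm_zero, mul_zero, E, if_true] at h0
    rw [zero_pow two_ne_zero, ENNReal.ofReal_zero, mul_zero, nonpos_iff_eq_zero] at h0
    have hu : Measurable u := (Lp.stronglyMeasurable u).measurable
    have hm : Measurable fun x => ∫⁻ y in Metric.ball p r, ‖u y - u x‖ₑ ^ 2 := by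
      refine Measurable.lintegral_prod_right' (f := fun q : _ × _ => ‖u q.2 - u q.1‖ₑ ^ 2) ?_
      fun_prop
    have h1 := (lintegral_eq_zero_iff hm).1 h0
    have hne : (ae (volume.restrict (Metric.ball p r))).NeBot := by
      rw [ae_neBot, Ne, Measure.restrict_eq_zero]
      exact (Metric.measure_ball_pos _ _ hrpos).ne'
    obtain ⟨x, hx⟩ := h1.exists
    have h2 := (lintegral_eq_zero_iff (by fun_prop)).1 hx
    refine ⟨r, hrpos, u x, (ae_restrict_iff' measurableSet_ball).1 ?_⟩
    filter_upwards [h2] with y hy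
    simpa [sub_eq_zero] using hy
  · rw [Metric.mem_ball, dist_eq_norm] at *
    have h3 := norm_add_le (x - p) (t • z)
    have h4 : ‖t • z‖ ≤ ‖z‖ := by
      rw [norm_smul, Real.norm_of_nonneg ht.1]
      exact mul_le_of_le_one_left (norm_nonneg _) ht.2
    rw [sub_zero] at hz
    rw [show x + t • z - p = x - p + t • z by abel]
    linarith
  · simpa using (Metric.mem_ball.1 hz).le
  · intro i j hij
    simp only [Function.onFun, E]
    rcases eq_or_ne i 0 with rfl | hi
    · rw [if_neg hij.symm]
      exact Set.disjoint_empty _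
    · rw [if_neg hi]
      exact Set.empty_disjoint _
  · intro k x hx y hy
    have h3 := Metric.mem_ball.1 (hE k hx)
    have h4 := Metric.mem_ball.1 (hE k hy)
    rw [Metric.mem_ball, dist_zero_right, ← dist_eq_norm]
    linarith [dist_triangle_right y x p]

/-- The sets `A c` of points near which `u = c` almost everywhere are open, pairwise disjoint and
cover Ω, so by connectedness one of them contains Ω. -/
theorem ae_eq_const_of_isWeakGradient_zero [IsFiniteMeasure (volume.restrict Ω)] (hΩ : IsOpen Ω)
    (hc : IsConnected Ω) {u : L2 Ω} (h : IsWeakGradient Ω u 0) :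
    ∃ c : ℝ, ∀ᵐ x ∂(volume.restrict Ω), u x = c := by
  let A : ℝ → Set (EuclideanSpace ℝ (Fin d)) := fun c =>
    {p | ∃ r > 0, ∀ᵐ x, x ∈ Metric.ball p r → u x = c}
  have hopen : ∀ c, IsOpen (A c) := fun c => Metric.isOpen_iff.2 fun p ⟨r, hr, hp⟩ => by
    refine ⟨r / 2, half_pos hr, fun q hq => ⟨r / 2, half_pos hr, ?_⟩⟩
    filter_upwards [hp] with x hx hxq
    refine hx (Metric.mem_ball.2 ?_)
    linarith [dist_triangle x q p, Metric.mem_ball.1 hxq, Metric.mem_ball.1 hq]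
  have hdisj : ∀ {c c' p}, p ∈ A c → p ∈ A c' → c = c' := by
    rintro c c' p ⟨r, hr, hp⟩ ⟨r', hr', hp'⟩
    have hne : (ae (volume.restrict (Metric.ball p (min r r')))).NeBot := by
      rw [ae_neBot, Ne, Measure.restrict_eq_zero]
      exact (Metric.measure_ball_pos _ _ (lt_min hr hr')).ne'
    have hand : ∀ᵐ x ∂(volume.restrict (Metric.ball p (min r r'))),
        ((x ∈ Metric.ball p r → u x = c) ∧ (x ∈ Metric.ball p r' → u x = c'))
          ∧ x ∈ Metric.ball p (min r r') :=
      (ae_restrict_of_ae (hp.and hp')).and (ae_restrict_mem measurableSet_ball)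
    obtain ⟨x, hx⟩ := hand.exists
    exact (hx.1.1 (Metric.ball_subset_ball (min_le_left _ _) hx.2)).symm.trans
      (hx.1.2 (Metric.ball_subset_ball (min_le_right _ _) hx.2))
  obtain ⟨p₀, hp₀⟩ := hc.nonempty
  obtain ⟨r, hr, c, hrc⟩ := exists_ball_ae_eq_const hΩ h hp₀
  have hsub : Ω ⊆ A c := by
    refine hc.isPreconnected.subset_left_of_subset_union (hopen c)
      (isOpen_biUnion (s := {c' | c' ≠ c}) fun c' _ => hopen c') ?_ ?_ ⟨p₀, hp₀, r, hr, hrc⟩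
    · refine Set.disjoint_left.2 fun p hp hp' => ?_
      obtain ⟨c', hc', hpc'⟩ := Set.mem_iUnion₂.1 hp'
      exact hc' (hdisj hpc' hp)
    · intro p hp
      obtain ⟨r, hr, c', hrc'⟩ := exists_ball_ae_eq_const hΩ h hp
      by_cases hcc : c' = c
      · exact Or.inl ⟨r, hr, hcc ▸ hrc'⟩
      · exact Or.inr (Set.mem_biUnion (x := c') hcc ⟨r, hr, hrc'⟩)
  refine ⟨c, (ae_restrict_iff' hΩ.measurableSet).2 ?_⟩
  have hnull : volume {x | x ∈ Ω ∧ u x ≠ c} = 0 := by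
    refine measure_null_of_locally_null _ fun x hx => ?_
    obtain ⟨r, hr, hrc⟩ := hsub hx.1
    refine ⟨_, inter_mem_nhdsWithin _ (Metric.ball_mem_nhds x hr), measure_mono_null ?_ (ae_iff.1 hrc)⟩
    rintro y ⟨hy, hyr⟩ himp
    exact hy.2 (himp hyr)
  rw [ae_iff]
  convert hnull using 3
  simp

/-! ### The space `H¹(Ω)` -/

/-- Each test of the weak gradient is the vanishing of a continuous functional on `L² × L²`, so the
graph is a closed subspace. -/
theorem exists_inner_add_inner_eq_zero_iff {φ : EuclideanSpace ℝ (Fin d) → ℝ}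
    (h1 : ContDiff ℝ ∞ φ) (h2 : HasCompactSupport φ) (i : Fin d) :
    ∃ (a : L2 Ω) (b : L2Vec Ω), ∀ (u : L2 Ω) (g : L2Vec Ω),
      ∫ x in Ω, u x * fderiv ℝ φ x (EuclideanSpace.single i 1) = - ∫ x in Ω, g x i * φ x ↔
        ⟪a, u⟫_ℝ + ⟪b, g⟫_ℝ = 0 := by
  have hm := memLp_of_contDiff h1 h2 2 (volume.restrict Ω)
  have ha : MemLp (fun x => fderiv ℝ φ x (EuclideanSpace.single i 1)) 2 (volume.restrict Ω) :=
    ((h1.continuous_fderiv (by simp)).clm_apply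
      continuous_const).memLp_of_hasCompactSupport (h2.fderiv_apply ℝ _)
  have hb : MemLp (fun x => φ x • EuclideanSpace.single i (1 : ℝ)) 2 (volume.restrict Ω) :=
    ((ContinuousLinearMap.id ℝ ℝ).smulRight (EuclideanSpace.single i (1 : ℝ))).comp_memLp' hm
  refine ⟨ha.toLp _, hb.toLp _, fun u g => ?_⟩
  have e1 : ∫ x in Ω, u x * fderiv ℝ φ x (EuclideanSpace.single i 1) = ⟪ha.toLp _, u⟫_ℝ := by
    rw [inner_eq_integral_mul]
    refine integral_congr_ae ?_
    filter_upwards [ha.coeFn_toLp] with x hx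
    rw [hx]
  have e2 : ∫ x in Ω, g x i * φ x = ⟪hb.toLp _, g⟫_ℝ := by
    rw [L2.inner_def]
    refine integral_congr_ae ?_
    filter_upwards [hb.coeFn_toLp] with x hx
    rw [hx, inner_smul_left, EuclideanSpace.inner_single_left]
    simp [mul_comm]
  rw [e1, e2, eq_neg_iff_add_eq_zero]

/-- `H¹(Ω)`, as the graph of the weak gradient in `L²(Ω) × L²(Ω; ℝᵈ)`. -/
def sobolevGraph (Ω : Set (EuclideanSpace ℝ (Fin d))) :
    Submodule ℝ (WithLp 2 (L2 Ω × L2Vec Ω)) where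
  carrier := {p | IsWeakGradient Ω p.fst p.snd}
  zero_mem' := fun φ h1 h2 _ i => by
    obtain ⟨a, b, h⟩ := exists_inner_add_inner_eq_zero_iff (Ω := Ω) h1 h2 i
    rw [h]
    simp
  add_mem' := fun {p q} hp hq φ h1 h2 h3 i => by
    obtain ⟨a, b, h⟩ := exists_inner_add_inner_eq_zero_iff (Ω := Ω) h1 h2 i
    have hp := (h _ _).1 (hp φ h1 h2 h3 i)
    have hq := (h _ _).1 (hq φ h1 h2 h3 i)
    rw [h, WithLp.add_fst, WithLp.add_snd, inner_add_right, inner_add_right]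
    linarith
  smul_mem' := fun c p hp φ h1 h2 h3 i => by
    obtain ⟨a, b, h⟩ := exists_inner_add_inner_eq_zero_iff (Ω := Ω) h1 h2 i
    have hp := (h _ _).1 (hp φ h1 h2 h3 i)
    rw [h, WithLp.smul_fst, WithLp.smul_snd, inner_smul_right, inner_smul_right, ← mul_add, hp,
      mul_zero]

theorem isClosed_sobolevGraph :
    IsClosed (sobolevGraph Ω : Set (WithLp 2 (L2 Ω × L2Vec Ω))) := by
  have : (sobolevGraph Ω : Set (WithLp 2 (L2 Ω × L2Vec Ω)))
      = {p | IsWeakGradient Ω p.fst p.snd} := rfl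
  rw [this]
  simp only [IsWeakGradient, Set.ofPred_forall]
  refine isClosed_iInter fun φ => isClosed_iInter fun h1 => isClosed_iInter fun h2 =>
    isClosed_iInter fun _ => isClosed_iInter fun i => ?_
  obtain ⟨a, b, h⟩ := exists_inner_add_inner_eq_zero_iff (Ω := Ω) h1 h2 i
  simp only [h]
  refine isClosed_eq ?_ continuous_const
  exact (continuous_const.inner (WithLp.fstL 2 ℝ (L2 Ω) (L2Vec Ω)).continuous).add
    (continuous_const.inner (WithLp.sndL 2 ℝ (L2 Ω) (L2Vec Ω)).continuous)

instance : CompleteSpace (sobolevGraph Ω) := isClosed_sobolevGraph.completeSpace_coe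

/-- The inclusion `H¹(Ω) → L²(Ω)`. -/
def sobolevInclusion (Ω : Set (EuclideanSpace ℝ (Fin d))) : sobolevGraph Ω →L[ℝ] L2 Ω :=
  (WithLp.fstL 2 ℝ (L2 Ω) (L2Vec Ω)).comp (sobolevGraph Ω).subtypeL

theorem isCompactOperator_of_forall_norm_sub_le {H G : Type*} [NormedAddCommGroup H]
    [NormedSpace ℝ H] [NormedAddCommGroup G] [NormedSpace ℝ G] [CompleteSpace G] {T : H →L[ℝ] G}
    (h : ∀ ε > 0, ∃ F : H →L[ℝ] G, IsCompactOperator F ∧ ∀ x, ‖T x - F x‖ ≤ ε * ‖x‖) :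
    IsCompactOperator T := by
  choose F hF1 hF2 using fun n : ℕ => h (1 / ((n : ℝ) + 1)) (by positivity)
  refine isCompactOperator_of_tendsto (l := atTop) (F := F) ?_ (.of_forall hF1)
  rw [tendsto_iff_norm_sub_tendsto_zero]
  refine squeeze_zero (fun _ => norm_nonneg _) (fun n => ?_) tendsto_one_div_add_atTop_nhds_zero_nat
  refine ContinuousLinearMap.opNorm_le_bound _ (by positivity) fun x => ?_
  rw [_root_.sub_apply, norm_sub_rev]
  exact hF2 n x

theorem isCompactOperator_sobolevInclusion (h : HasCompactApprox Ω Ω) :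
    IsCompactOperator (sobolevInclusion Ω) := by
  refine isCompactOperator_of_forall_norm_sub_le fun ε hε => ?_
  obtain ⟨F, hF1, -, hF3⟩ := h ε hε
  refine ⟨F.comp (sobolevInclusion Ω), hF1.comp_clm _, fun p => ?_⟩
  have h1 := hF3 p.1.fst p.1.snd p.2
  have h2 : ∫⁻ x in Ω, ‖p.1.fst x - F p.1.fst x‖ₑ ^ 2
      = ENNReal.ofReal (‖p.1.fst - F p.1.fst‖ ^ 2) := by
    rw [← lintegral_enorm_sq_coeFn]
    refine lintegral_congr_ae ?_
    filter_upwards [Lp.coeFn_sub p.1.fst (F p.1.fst)] with x hx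
    rw [hx, Pi.sub_apply]
  rw [h2, ENNReal.ofReal_le_ofReal_iff (by positivity),
    pow_le_pow_iff_left₀ (norm_nonneg _) (by positivity) two_ne_zero] at h1
  refine h1.trans (mul_le_mul_of_nonneg_left ?_ hε.le)
  exact WithLp.norm_snd_le _ p.1

theorem exists_isWeakGradient_of_mem_testSubmodule {v : L2 Ω} (hv : v ∈ testSubmodule Ω) :
    ∃ g, IsWeakGradient Ω v g := by
  obtain ⟨φ, h1, h2, -, h4⟩ := hv
  let G : EuclideanSpace ℝ (Fin d) → EuclideanSpace ℝ (Fin d) := fun x =>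
    (InnerProductSpace.toDual ℝ _).symm (fderiv ℝ φ x)
  have hG : ∀ x i, G x i = fderiv ℝ φ x (EuclideanSpace.single i 1) := fun x i => by
    rw [← InnerProductSpace.toDual_symm_apply, EuclideanSpace.inner_single_right]
    simp [G]
  have hm : MemLp G 2 (volume.restrict Ω) := by
    refine Continuous.memLp_of_hasCompactSupport ?_ ?_
    · exact (LinearIsometryEquiv.continuous _).comp (h1.continuous_fderiv (by simp))
    · exact (h2.fderiv ℝ).comp_left (map_zero _)
  refine ⟨hm.toLp G, fun χ k1 k2 k3 i => ?_⟩
  calc ∫ x in Ω, v x * fderiv ℝ χ x (EuclideanSpace.single i 1)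
      = ∫ x in Ω, φ x * fderiv ℝ χ x (EuclideanSpace.single i 1) := by
        refine integral_congr_ae ?_
        filter_upwards [h4] with x hx
        rw [hx]
    _ = - ∫ x in Ω, fderiv ℝ φ x (EuclideanSpace.single i 1) * χ x :=
        setIntegral_mul_fderiv_eq_neg h1 k1 k2 k3 _
    _ = - ∫ x in Ω, hm.toLp G x i * χ x := by
        congr 1
        refine integral_congr_ae ?_
        filter_upwards [hm.coeFn_toLp] with x hx
        rw [hx, hG]

end

section

variable {d : ℕ} {Ω : Set (EuclideanSpace ℝ (Fin d))}

/-! ### The Neumann eigenbasis -/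

/-- Indicators of infinitely many disjoint nonempty open subsets of Ω are orthogonal and nonzero.
Having `d ≥ 1` makes Ω infinite. -/
theorem not_finiteDimensional_L2 [IsFiniteMeasure (volume.restrict Ω)] (hd : 1 ≤ d)
    (hΩ : IsOpen Ω) (hne : Ω.Nonempty) : ¬ FiniteDimensional ℝ (L2 Ω) := by
  intro hfd
  have : NeZero d := ⟨by omega⟩
  obtain ⟨p, hp⟩ := hne
  have : Infinite Ω := (infinite_of_mem_nhds p (hΩ.mem_nhds hp)).to_subtype
  obtain ⟨U, hUi, hUo, hUd⟩ := exists_seq_infinite_isOpen_pairwise_disjoint Ω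
  let S : ℕ → Set (EuclideanSpace ℝ (Fin d)) := fun n => Subtype.val '' U n
  have hSo : ∀ n, IsOpen (S n) := fun n => hΩ.isOpenMap_subtype_val _ (hUo n)
  have hSΩ : ∀ n, S n ⊆ Ω := fun n => by
    rintro _ ⟨x, -, rfl⟩
    exact x.2
  have hSd : ∀ m n, m ≠ n → S m ∩ S n = ∅ := fun m n hmn =>
    Set.disjoint_iff_inter_eq_empty.1
      ((Set.disjoint_image_iff Subtype.val_injective).2 (hUd hmn))
  let e : ℕ → L2 Ω := fun n =>
    indicatorConstLp 2 (hSo n).measurableSet (measure_ne_top _ _) (1 : ℝ)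
  have hinner : ∀ m n, ⟪e m, e n⟫_ℝ = (volume.restrict Ω).real (S m ∩ S n) := fun m n =>
    L2.real_inner_indicatorConstLp_one_indicatorConstLp_one _ _ _ _
  have hli : LinearIndependent ℝ e := by
    refine linearIndependent_of_ne_zero_of_inner_eq_zero (𝕜 := ℝ) (fun n h0 => ?_) fun m n hmn => ?_
    · have h1 := hinner n n
      rw [h0, inner_zero_left, Set.inter_self, eq_comm, measureReal_eq_zero_iff,
        Measure.restrict_apply (hSo n).measurableSet, Set.inter_eq_left.2 (hSΩ n)] at h1
      exact ((hSo n).measure_pos volume ((hUi n).nonempty.image _)).ne' h1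
    · exact (hinner m n).trans (by rw [hSd m n hmn, measureReal_empty])
  exact not_finite_iff_infinite.2 inferInstance hli.finite_of_isNoetherian

theorem IsNegNeumannLaplacian.inner_oneL2_eq_zero [IsFiniteMeasure (volume.restrict Ω)]
    {u w : L2 Ω} (h : IsNegNeumannLaplacian Ω u w) : ⟪oneL2 Ω, w⟫_ℝ = 0 := by
  obtain ⟨g, -, h⟩ := h
  have h1 := h _ _ (isWeakGradient_oneL2 (Ω := Ω))
  rwa [← inner_eq_integral_mul, ← L2.inner_def (𝕜 := ℝ), inner_zero_right] at h1

theorem IsNegNeumannLaplacian.inner_self_nonneg {u w : L2 Ω} (h : IsNegNeumannLaplacian Ω u w) :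
    0 ≤ ⟪u, w⟫_ℝ := by
  obtain ⟨g, hg, h⟩ := h
  rw [inner_eq_integral_mul, h u g hg, ← L2.inner_def (𝕜 := ℝ)]
  exact real_inner_self_nonneg

/-- On a connected domain the kernel of the Neumann Laplacian consists of constants. -/
theorem IsNegNeumannLaplacian.eq_smul_oneL2 [IsFiniteMeasure (volume.restrict Ω)]
    (hΩ : IsOpen Ω) (hc : IsConnected Ω) {u : L2 Ω} (h : IsNegNeumannLaplacian Ω u 0) :
    ∃ c : ℝ, u = c • oneL2 Ω := by
  obtain ⟨g, hg, h⟩ := h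
  have h1 := h u g hg
  rw [← inner_eq_integral_mul, ← L2.inner_def (𝕜 := ℝ), inner_zero_right, eq_comm,
    inner_self_eq_zero] at h1
  rw [h1] at hg
  obtain ⟨c, hc⟩ := ae_eq_const_of_isWeakGradient_zero hΩ hc hg
  refine ⟨c, Lp.ext_iff.2 ?_⟩
  filter_upwards [hc, Lp.coeFn_smul c (oneL2 Ω), oneL2_coeFn (Ω := Ω)] with x h1 h2 h3
  rw [h1, h2, Pi.smul_apply, h3, smul_eq_mul, mul_one]

/-! ### The resolvent and its eigenvectors -/

open ContinuousLinearMap in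
/-- The operator `(1 - Δ_N)⁻¹` on `L²(Ω)`. -/
def resolvent (Ω : Set (EuclideanSpace ℝ (Fin d))) : L2 Ω →L[ℝ] L2 Ω :=
  (sobolevInclusion Ω).comp (adjoint (sobolevInclusion Ω))

theorem inner_resolvent (u v : L2 Ω) :
    ⟪resolvent Ω u, v⟫_ℝ = ⟪(sobolevInclusion Ω).adjoint u, (sobolevInclusion Ω).adjoint v⟫_ℝ := by
  rw [ContinuousLinearMap.adjoint_inner_right]
  rfl

theorem resolvent_isSymmetric : (resolvent Ω).IsSymmetric := fun u v => by
  change ⟪resolvent Ω u, v⟫_ℝ = ⟪u, resolvent Ω v⟫_ℝ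
  rw [inner_resolvent, real_inner_comm _ u, inner_resolvent, real_inner_comm]

/-- The form is `‖J* u‖²` for the inclusion `J`. If `J* u = 0`, then `u` is orthogonal to the range
of `J`, in particular to all test functions. -/
theorem inner_resolvent_self_pos [IsFiniteMeasure (volume.restrict Ω)] (hΩ : IsOpen Ω) {u : L2 Ω}
    (hu : u ≠ 0) : 0 < ⟪resolvent Ω u, u⟫_ℝ := by
  rw [inner_resolvent, real_inner_self_pos]
  intro h0
  refine hu ?_
  have h1 : u ∈ (testSubmodule Ω)ᗮ := fun v hv => by
    obtain ⟨g, hg⟩ := exists_isWeakGradient_of_mem_testSubmodule hv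
    have h2 := (sobolevInclusion Ω).adjoint_inner_right
      ⟨WithLp.toLp 2 (v, g), hg⟩ u
    rw [h0, inner_zero_right] at h2
    exact h2.symm
  rwa [testSubmodule_orthogonal hΩ, Submodule.mem_bot] at h1

/-- The adjoint identity for `η = J* u` is the weak form of `η - Δ_N η = u`; insert `η = μ u` and
divide by `μ`. -/
theorem isNegNeumannLaplacian_of_resolvent_eq_smul {u : L2 Ω} {μ : ℝ} (hμ : μ ≠ 0)
    (h : resolvent Ω u = μ • u) : IsNegNeumannLaplacian Ω u ((μ⁻¹ - 1) • u) := by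
  set η := (sobolevInclusion Ω).adjoint u with hη
  have h1 : η.1.fst = μ • u := h
  refine ⟨μ⁻¹ • η.1.snd, ?_, fun v k hk => ?_⟩
  · have h2 : IsWeakGradient Ω (μ⁻¹ • η.1.fst) (μ⁻¹ • η.1.snd) :=
      ((sobolevGraph Ω).smul_mem μ⁻¹ η.2 :)
    rwa [h1, inv_smul_smul₀ hμ] at h2
  · have h2 := (sobolevInclusion Ω).adjoint_inner_left ⟨WithLp.toLp 2 (v, k), hk⟩ u
    have h3 : ⟪η.1.fst, v⟫_ℝ + ⟪η.1.snd, k⟫_ℝ = ⟪u, v⟫_ℝ := h2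
    rw [h1, inner_smul_left, conj_trivial] at h3
    rw [← inner_eq_integral_mul, ← L2.inner_def (𝕜 := ℝ), inner_smul_right, inner_smul_left,
      conj_trivial, real_inner_comm]
    have h4 : ⟪η.1.snd, k⟫_ℝ = (1 - μ) * ⟪u, v⟫_ℝ := by linarith
    rw [h4]
    field_simp

theorem oneL2_ne_zero [IsFiniteMeasure (volume.restrict Ω)] (hΩ : IsOpen Ω) (hne : Ω.Nonempty) :
    oneL2 Ω ≠ 0 := by
  intro h
  have h1 : ⟪oneL2 Ω, oneL2 Ω⟫_ℝ = (volume.restrict Ω).real (Set.univ ∩ Set.univ) :=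
    L2.real_inner_indicatorConstLp_one_indicatorConstLp_one _ _ _ _
  rw [h, inner_zero_left, Set.inter_self, eq_comm, measureReal_eq_zero_iff,
    Measure.restrict_apply_univ] at h1
  exact (hΩ.measure_pos volume hne).ne' h1

theorem nonempty_neumannEigenbasis (hd : 1 ≤ d) (hΩ : IsBoundedLipschitzDomain Ω)
    [IsFiniteMeasure (volume.restrict Ω)] : Nonempty (NeumannEigenbasis Ω) := by
  have hcomp : IsCompactOperator (resolvent Ω) :=
    (isCompactOperator_sobolevInclusion (hasCompactApprox_self hΩ.isOpen hΩ.isBounded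
      fun p hp => exists_uniformCone hΩ.isOpen hΩ.lipschitz hp)).comp_clm _
  obtain ⟨b, μ, hb, hpos, hanti, hlim⟩ := exists_hilbertBasis_eigenvectors
    (not_finiteDimensional_L2 hd hΩ.isOpen hΩ.isConnected.nonempty) hcomp resolvent_isSymmetric
    fun u hu => inner_resolvent_self_pos hΩ.isOpen hu
  have hone := oneL2_ne_zero hΩ.isOpen hΩ.isConnected.nonempty
  set eig : ℕ → ℝ := fun k => (μ k)⁻¹ - 1 with heig
  have hEig : ∀ k, IsNegNeumannLaplacian Ω (b k) (eig k • b k) := fun k =>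
    isNegNeumannLaplacian_of_resolvent_eq_smul (hpos k).ne' (hb k)
  have hmono : Monotone eig := fun i j hij =>
    sub_le_sub_right (inv_anti₀ (hpos j) (hanti hij)) 1
  have hnonneg : ∀ k, 0 ≤ eig k := fun k => by
    have := (hEig k).inner_self_nonneg
    rwa [inner_smul_right, real_inner_self_eq_norm_sq, b.orthonormal.norm_eq_one, one_pow,
      mul_one] at this
  -- Otherwise all eigenvalues are positive, every `b k` is orthogonal to `1`, and completeness of
  -- the basis gives `1 = 0`.
  have hzero : eig 0 = 0 := by
    by_contra h0
    have hort : ∀ k, ⟪b k, oneL2 Ω⟫_ℝ = 0 := fun k => by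
      have h1 := (hEig k).inner_oneL2_eq_zero
      rw [inner_smul_right, real_inner_comm] at h1
      refine (mul_eq_zero.1 h1).resolve_left ?_
      exact (((hnonneg 0).lt_of_ne' h0).trans_le (hmono (Nat.zero_le k))).ne'
    have h1 := b.hasSum_repr (oneL2 Ω)
    simp only [b.repr_apply_apply, hort, zero_smul] at h1
    exact hone (h1.unique hasSum_zero)
  -- Otherwise `b 0` and `b 1` are both nonzero multiples of `1`, and so not orthogonal.
  have hone_pos : 0 < eig 1 := by
    refine (hnonneg 1).lt_of_ne' fun h1 => ?_
    have hconst : ∀ k, eig k = 0 → ∃ c : ℝ, b k = c • oneL2 Ω := fun k hk => by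
      have := hEig k
      rw [hk, zero_smul] at this
      exact this.eq_smul_oneL2 hΩ.isOpen hΩ.isConnected
    obtain ⟨c₀, h₀⟩ := hconst 0 hzero
    obtain ⟨c₁, h₁⟩ := hconst 1 h1
    have hi := b.orthonormal.inner_eq_zero zero_ne_one
    rw [h₀, h₁, inner_smul_left, inner_smul_right, conj_trivial, mul_eq_zero, mul_eq_zero,
      inner_self_eq_zero] at hi
    rcases hi with hi | hi | hi
    · exact b.orthonormal.ne_zero 0 (by rw [h₀, hi, zero_smul])
    · exact b.orthonormal.ne_zero 1 (by rw [h₁, hi, zero_smul])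
    · exact hone hi
  refine ⟨⟨b, eig, hEig, hzero, hone_pos, hmono, ?_⟩⟩
  refine tendsto_atTop_add_const_right _ (-1) ?_
  exact tendsto_inv_nhdsGT_zero.comp
    (tendsto_nhdsWithin_iff.2 ⟨hlim, .of_forall fun k => hpos k⟩)

end

end FracNeumann

end

/-! ### The theorem -/

theorem theoremA1 {d : ℕ} (hd : 1 ≤ d) (Ω : Set (EuclideanSpace ℝ (Fin d)))
    (hΩ : FracNeumann.IsBoundedLipschitzDomain Ω) :
    Nonempty (FracNeumann.NeumannEigenbasis Ω) ∧
    ∀ (B : FracNeumann.NeumannEigenbasis Ω) (s : ℝ), 0 < s → s < 1 →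
      ∀ f : B.HStarDual s,
        ∃ u : B.HStar s, B.IsWeakSolution f u ∧ (∀ w : B.HStar s, B.IsWeakSolution f w → w = u) ∧
          ‖u‖ ≤ ‖f‖ := by
  have hfin : IsFiniteMeasure (volume.restrict Ω) :=
    ⟨by simpa using hΩ.isBounded.measure_lt_top⟩
  exact ⟨FracNeumann.nonempty_neumannEigenbasis hd hΩ,
    fun B s hs _ f => B.exists_unique_isWeakSolution hs.le f⟩
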